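/- Write $L^2=L^2_{\mathbb C}(0,1)$ and $L^2\times L^2$ for the Hilbert space with inner product the sum of the two component inner products. Put $S_0=\mathrm{Id}$ and, for $a\in\mathbb N=\{0,1,2,\dots\}$, let $S_{a+1}$ be the bounded operator of $L^2\times L^2$ given by $$S_{a+1}[p,q](x)=\Big(p(x)-2(2a+1)x^{2a}\int_x^1\frac{p(t)}{t^{2a+1}}\,dt,\; q(x)-2(2a+1)x^{2a+1}\int_x^1\frac{q(t)}{t^{2a+2}}\,dt\Big).$$ Let $T_0=-S_0$, $T_a=(-1)^{a+1}S_aS_{a-1}\cdots S_1$ for $a\ge 1$, and $N_k=\ker S_k^*$ for $k\ge1$. Let $j_n(z)=\sqrt{\pi z/2}\,J_{n+1/2}(z)$ and $\eta_n(z)=(-1)^n\sqrt{\pi z/2}\,J_{-n-1/2}(z)$ for integers $n\ge-1$, where $J_\nu$ is the Bessel function of the first kind, and $$\Phi_a=\begin{bmatrix}-2j_{a-1}j_a\\ j_a^2-j_{a-1}^2\end{bmatrix},\qquad \Psi_a=\begin{bmatrix}-\eta_{a-1}j_a-\eta_aj_{a-1}\\ -\eta_{a-1}j_{a-1}+\eta_aj_a\end{bmatrix},$$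 extended by continuity to $z=0$. Below, $\cdot$ is the bilinear (unconjugated) product of $\mathbb C^2$. Let $T_a^1,T_a^2$ be the operators of $L^2$ such that $T_a[f,g]=(T_a^1[f],T_a^2[g])$. Then for every $a\in\mathbb N$: (i) $T_a$ is a bounded, one-to-one operator on $L^2\times L^2$ such that for all $p,q\in L^2$ and all $\lambda\in\mathbb C$ $$\int_0^1\Phi_a(\lambda t)\cdot\begin{bmatrix}p(t)\\q(t)\end{bmatrix}dt=\int_0^1\begin{bmatrix}\sin(2\lambda t)\\ \cos(2\lambda t)\end{bmatrix}\cdot T_a[p,q](t)\,dt,$$ $$\int_0^1\Psi_a(\lambda t)\cdot\begin{bmatrix}p(t)\\q(t)\end{bmatrix}dt=\int_0^1\begin{bmatrix}\cos(2\lambda t)\\ -\sin(2\lambda t)\end{bmatrix}\cdot T_a[p,q](t)\,dt,$$ the integrands on the left being integrable. (ii) The adjoint is $T_a^*[f,g]=\big((T_a^1)^*[f],(T_a^2)^*[g]\big)$. For all $\lambda\in\mathbb C$, as elements of $L^2\times L^2$, $$\Phi_a(\lambda x)=T_a^*\begin{bmatrix}\sin(2\lambda x)\\ \cos(2\lambda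 x)\end{bmatrix},\qquad \Psi_a(\lambda x)=T_a^*\begin{bmatrix}\cos(2\lambda x)\\ -\sin(2\lambda x)\end{bmatrix},$$ and $\ker T_a^*=\bigoplus_{k=1}^aN_k$ (an internal direct sum, $\{0\}$ for $a=0$). (iii) $T_a$ is a linear isomorphism of $L^2\times L^2$ onto $\big(\bigoplus_{k=1}^aN_k\big)^\perp$, with bounded inverse. The inverse is the restriction to this subspace of the bounded operator $B_a$ on $L^2\times L^2$ defined by $B_a[f,g]=\big((T_a^2)^*[f],(T_a^1)^*[g]\big)$. -/

import Mathlib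

open MeasureTheory Set Filter Topology
open scoped ENNReal

namespace AKNS

noncomputable section

/-! ### The Hilbert spaces `L²(0,1)` and `L²(0,1) × L²(0,1)` -/

/-- Lebesgue measure on `(0,1)`. -/
abbrev μ01 : Measure ℝ := volume.restrict (Ioo (0:ℝ) 1)

/-- The complex Hilbert space `L²(0,1)`. -/
abbrev L2C : Type := Lp ℂ 2 μ01

/-- The Hilbert space `L²(0,1) × L²(0,1)`, with the sum of the two inner products. -/
abbrev H : Type := WithLp 2 (L2C × L2C)

/-- The element `(f, g)` of `L²(0,1) × L²(0,1)`. -/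
abbrev vec (f g : L2C) : H := WithLp.toLp 2 (f, g)

/-- The operator `(f, g) ↦ (A f, B g)`. -/
def diagOp (A B : L2C →L[ℂ] L2C) : H →L[ℂ] H :=
  (WithLp.prodContinuousLinearEquiv 2 ℂ L2C L2C).symm.toContinuousLinearMap ∘L
    (A.prodMap B) ∘L (WithLp.prodContinuousLinearEquiv 2 ℂ L2C L2C).toContinuousLinearMap

lemma diagOp_vec (A B : L2C →L[ℂ] L2C) (f g : L2C) : diagOp A B (vec f g) = vec (A f) (B g) := rfl

/-! ### A Hardy inequality, which makes the operators below well defined -/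

lemma tail_bound {x : ℝ} (hx : 0 < x) (hx1 : x < 1) :
    ∫⁻ t in Ioo x 1, ENNReal.ofReal (t ^ (-(3/2) : ℝ)) ≤ ENNReal.ofReal (2 * x ^ (-(1/2) : ℝ)) := by
  have hint : IntervalIntegrable (fun t : ℝ => t ^ (-(3/2) : ℝ)) volume x 1 :=
    intervalIntegral.intervalIntegrable_rpow (Or.inr (by
      rw [uIcc_of_le hx1.le]; intro h; exact absurd h.1 (not_le.2 hx)))
  have hion : IntegrableOn (fun t : ℝ => t ^ (-(3/2) : ℝ)) (Ioo x 1) :=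
    ((intervalIntegrable_iff_integrableOn_Ioc_of_le hx1.le).1 hint).mono_set Ioo_subset_Ioc_self
  rw [← ofReal_integral_eq_lintegral_ofReal hion]
  · apply ENNReal.ofReal_le_ofReal
    rw [← integral_Ioc_eq_integral_Ioo, ← intervalIntegral.integral_of_le hx1.le, integral_rpow]
    · norm_num
      linarith
    · right
      refine ⟨by norm_num, ?_⟩
      rw [uIcc_of_le hx1.le]; intro h; exact absurd h.1 (not_le.2 hx)
  · filter_upwards [ae_restrict_mem measurableSet_Ioo] with t ht
    exact Real.rpow_nonneg (hx.trans ht.1).le _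

lemma head_bound {t : ℝ} (ht : 0 < t) :
    ∫⁻ x in Ioo 0 t, ENNReal.ofReal (2 * x ^ (-(1/2) : ℝ)) ≤ ENNReal.ofReal (4 * t ^ ((1/2) : ℝ)) := by
  have hint : IntervalIntegrable (fun x : ℝ => 2 * x ^ (-(1/2) : ℝ)) volume 0 t :=
    (intervalIntegral.intervalIntegrable_rpow' (by norm_num)).const_mul 2
  have hion : IntegrableOn (fun x : ℝ => 2 * x ^ (-(1/2) : ℝ)) (Ioo 0 t) :=
    ((intervalIntegrable_iff_integrableOn_Ioc_of_le ht.le).1 hint).mono_set Ioo_subset_Ioc_self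
  rw [← ofReal_integral_eq_lintegral_ofReal hion]
  · apply ENNReal.ofReal_le_ofReal
    rw [← integral_Ioc_eq_integral_Ioo, ← intervalIntegral.integral_of_le ht.le,
      intervalIntegral.integral_const_mul, integral_rpow (Or.inl (by norm_num))]
    norm_num
    linarith
  · filter_upwards [ae_restrict_mem measurableSet_Ioo] with x hx
    have := Real.rpow_nonneg hx.1.le (-(1/2) : ℝ)
    positivity

lemma hardy (g : ℝ → ℝ≥0∞) (hg : Measurable g) :
    ∫⁻ x in Ioo (0:ℝ) 1, (∫⁻ t in Ioo x 1, g t * ENNReal.ofReal t⁻¹) ^ 2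
      ≤ 4 * ∫⁻ t in Ioo (0:ℝ) 1, g t ^ 2 := by
  have h1 : ∀ x ∈ Ioo (0:ℝ) 1, (∫⁻ t in Ioo x 1, g t * ENNReal.ofReal t⁻¹) ^ 2 ≤
      ∫⁻ t in Ioo (0:ℝ) 1, (Ioi x).indicator (fun t => g t ^ 2 * ENNReal.ofReal (t ^ (-(1/2) : ℝ))
        * ENNReal.ofReal (2 * x ^ (-(1/2) : ℝ))) t := by
    intro x hx
    have hcs := ENNReal.lintegral_mul_le_Lp_mul_Lq (volume.restrict (Ioo x 1))
      Real.HolderConjugate.two_two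
      (f := fun t => g t * ENNReal.ofReal (t ^ (-(1/4) : ℝ)))
      (g := fun t => ENNReal.ofReal (t ^ (-(3/4) : ℝ))) (by fun_prop) (by fun_prop)
    have he : ∫⁻ t in Ioo x 1, g t * ENNReal.ofReal t⁻¹ = ∫⁻ t in Ioo x 1,
        ((fun t => g t * ENNReal.ofReal (t ^ (-(1/4) : ℝ))) *
          (fun t => ENNReal.ofReal (t ^ (-(3/4) : ℝ)))) t := by
      refine setLIntegral_congr_fun measurableSet_Ioo fun t ht => ?_
      have ht0 : 0 < t := hx.1.trans ht.1
      simp only [Pi.mul_apply]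
      rw [mul_assoc, ← ENNReal.ofReal_mul (Real.rpow_nonneg ht0.le _), ← Real.rpow_add ht0]
      norm_num [Real.rpow_neg_one]
    rw [he]
    refine (pow_le_pow_left' hcs 2).trans ?_
    rw [mul_pow, ← ENNReal.rpow_natCast, ← ENNReal.rpow_mul, ← ENNReal.rpow_natCast,
      ← ENNReal.rpow_mul]
    norm_num only [Nat.cast_ofNat, ENNReal.rpow_one]
    have e1 : ∫⁻ t in Ioo (0:ℝ) 1, (Ioi x).indicator (fun t => g t ^ 2 *
        ENNReal.ofReal (t ^ (-(1/2) : ℝ)) * ENNReal.ofReal (2 * x ^ (-(1/2) : ℝ))) t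
        = (∫⁻ t in Ioo x 1, g t ^ 2 * ENNReal.ofReal (t ^ (-(1/2) : ℝ))) *
          ENNReal.ofReal (2 * x ^ (-(1/2) : ℝ)) := by
      rw [lintegral_indicator measurableSet_Ioi, Measure.restrict_restrict measurableSet_Ioi,
        lintegral_mul_const _ (by fun_prop)]
      have : Ioi x ∩ Ioo 0 1 = Ioo x 1 := by
        ext t; simp only [mem_inter_iff, mem_Ioi, mem_Ioo]
        exact ⟨fun h => ⟨h.1, h.2.2⟩, fun h => ⟨h.1, hx.1.trans h.1, h.2⟩⟩
      rw [this]
    rw [e1]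
    gcongr ?_ * ?_
    · refine le_of_eq (setLIntegral_congr_fun measurableSet_Ioo fun t ht => ?_)
      have ht0 : 0 < t := hx.1.trans ht.1
      rw [ENNReal.mul_rpow_of_nonneg _ _ (by norm_num), ENNReal.ofReal_rpow_of_pos
        (Real.rpow_pos_of_pos ht0 _), ← Real.rpow_mul ht0.le]
      norm_num
    · refine le_trans (le_of_eq (setLIntegral_congr_fun measurableSet_Ioo fun t ht => ?_))
        (tail_bound hx.1 hx.2)
      have ht0 : 0 < t := hx.1.trans ht.1
      rw [ENNReal.ofReal_rpow_of_pos (Real.rpow_pos_of_pos ht0 _), ← Real.rpow_mul ht0.le]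
      norm_num
  refine (setLIntegral_mono' measurableSet_Ioo h1).trans ?_
  rw [lintegral_lintegral_swap]
  · rw [← lintegral_const_mul _ (by fun_prop)]
    refine setLIntegral_mono' measurableSet_Ioo fun t ht => ?_
    have e2 : ∀ x : ℝ, (Ioi x).indicator (fun t => g t ^ 2 * ENNReal.ofReal (t ^ (-(1/2) : ℝ))
        * ENNReal.ofReal (2 * x ^ (-(1/2) : ℝ))) t = g t ^ 2 * ENNReal.ofReal (t ^ (-(1/2) : ℝ)) *
        (Iio t).indicator (fun x => ENNReal.ofReal (2 * x ^ (-(1/2) : ℝ))) x := by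
      intro x
      by_cases h : x < t <;> simp [indicator, h]
    simp_rw [e2]
    rw [lintegral_const_mul _ (Measurable.indicator (by fun_prop) measurableSet_Iio),
      lintegral_indicator measurableSet_Iio, Measure.restrict_restrict measurableSet_Iio]
    have : Iio t ∩ Ioo 0 1 = Ioo 0 t := by
      ext x; simp only [mem_inter_iff, mem_Iio, mem_Ioo]
      exact ⟨fun h => ⟨h.2.1, h.1⟩, fun h => ⟨h.2, h.1, h.2.trans ht.2⟩⟩
    rw [this]
    refine (mul_le_mul_right (head_bound ht.1) _).trans ?_
    rw [mul_assoc, ← ENNReal.ofReal_mul (Real.rpow_nonneg ht.1.le _), mul_left_comm,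
      ← Real.rpow_add ht.1]
    norm_num
    rw [mul_comm]
  · have hm : MeasurableSet {q : ℝ × ℝ | q.1 < q.2} := measurableSet_lt measurable_fst measurable_snd
    refine Measurable.aemeasurable ?_
    have : (Function.uncurry fun x t => (Ioi x).indicator (fun t => g t ^ 2 *
        ENNReal.ofReal (t ^ (-(1/2) : ℝ)) * ENNReal.ofReal (2 * x ^ (-(1/2) : ℝ))) t) =
        {q : ℝ × ℝ | q.1 < q.2}.indicator (fun q => g q.2 ^ 2 *
        ENNReal.ofReal (q.2 ^ (-(1/2) : ℝ)) * ENNReal.ofReal (2 * q.1 ^ (-(1/2) : ℝ))) := by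
      ext ⟨x, t⟩
      simp [Function.uncurry, indicator]
    rw [this]
    exact Measurable.indicator (by fun_prop) hm

/-- `x ↦ x ^ m * ∫_x^1 p(t) / t^(m+1) dt`. -/
def tailAverage (m : ℕ) (p : ℝ → ℂ) (x : ℝ) : ℂ :=
  (x : ℂ) ^ m * ∫ t in x..1, p t / (t : ℂ) ^ (m + 1)

lemma tail_eq {m : ℕ} {p : ℝ → ℂ} {x : ℝ} (hx : x < 1) :
    tailAverage m p x = (x : ℂ) ^ m * ∫ t in Ioo x 1, p t / (t : ℂ) ^ (m + 1) := by
  rw [tailAverage, intervalIntegral.integral_of_le hx.le, integral_Ioc_eq_integral_Ioo]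

lemma enorm_tail_le {m : ℕ} {p : ℝ → ℂ} {x : ℝ} (hx : x ∈ Ioo (0:ℝ) 1) :
    ‖tailAverage m p x‖ₑ ≤ ∫⁻ t in Ioo x 1, ‖p t‖ₑ * ENNReal.ofReal t⁻¹ := by
  rw [tail_eq hx.2, ← integral_const_mul]
  refine (enorm_integral_le_lintegral_enorm _).trans ?_
  refine setLIntegral_mono' measurableSet_Ioo fun t ht => ?_
  have ht0 : 0 < t := hx.1.trans ht.1
  have : (x : ℂ) ^ m * (p t / (t : ℂ) ^ (m + 1)) = p t * ((((x / t) ^ m * t⁻¹ : ℝ)) : ℂ) := by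
    push_cast
    have : (t : ℂ) ≠ 0 := by exact_mod_cast ht0.ne'
    rw [div_pow]
    field_simp
    ring
  rw [this, enorm_mul]
  gcongr
  have h0 : 0 ≤ (x / t) ^ m * t⁻¹ := by have := hx.1; positivity
  rw [← ofReal_norm, Complex.norm_real, Real.norm_of_nonneg h0]
  apply ENNReal.ofReal_le_ofReal
  have : (x / t) ^ m ≤ 1 := pow_le_one₀ (div_nonneg hx.1.le ht0.le) ((div_le_one ht0).2 ht.1.le)
  exact mul_le_of_le_one_left (by positivity) this

lemma tail_congr {m : ℕ} {p q : ℝ → ℂ} (h : p =ᵐ[μ01] q) {x : ℝ} (hx : x ∈ Ioo (0:ℝ) 1) :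
    tailAverage m p x = tailAverage m q x := by
  rw [tail_eq hx.2, tail_eq hx.2]
  congr 1
  refine integral_congr_ae ?_
  have : p =ᵐ[volume.restrict (Ioo x 1)] q :=
    ae_restrict_of_ae_restrict_of_subset (Ioo_subset_Ioo_left hx.1.le) h
  filter_upwards [this] with t ht
  rw [ht]

lemma tail_integrable {m : ℕ} {p : ℝ → ℂ} (hp : MemLp p 2 μ01) {x : ℝ} (hx : x ∈ Ioo (0:ℝ) 1) :
    IntegrableOn (fun t => p t / (t : ℂ) ^ (m + 1)) (Ioo x 1) := by
  have h1 : IntegrableOn p (Ioo x 1) :=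
    IntegrableOn.mono_set (hp.integrable (by norm_num)) (Ioo_subset_Ioo_left hx.1.le)
  simp_rw [div_eq_mul_inv]
  refine Integrable.mul_bdd (c := (x ^ (m + 1))⁻¹) h1 ?_ ?_
  · exact Measurable.aestronglyMeasurable (by fun_prop)
  · filter_upwards [ae_restrict_mem measurableSet_Ioo] with t ht
    rw [norm_inv, norm_pow, Complex.norm_real, Real.norm_of_nonneg (hx.1.trans ht.1).le]
    have := hx.1
    have := ht.1.le
    gcongr

lemma tail_add {m : ℕ} {p q : ℝ → ℂ} (hp : MemLp p 2 μ01) (hq : MemLp q 2 μ01) {x : ℝ}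
    (hx : x ∈ Ioo (0:ℝ) 1) :
    tailAverage m (p + q) x = tailAverage m p x + tailAverage m q x := by
  rw [tail_eq hx.2, tail_eq hx.2, tail_eq hx.2, ← mul_add,
    ← integral_add (tail_integrable hp hx) (tail_integrable hq hx)]
  simp only [Pi.add_apply, add_div]

lemma tail_smul {m : ℕ} (c : ℂ) (p : ℝ → ℂ) (x : ℝ) :
    tailAverage m (c • p) x = c * tailAverage m p x := by
  unfold tailAverage
  rw [mul_left_comm]
  simp only [Pi.smul_apply, smul_eq_mul, mul_div_assoc, intervalIntegral.integral_const_mul]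

lemma tail_aesm (m : ℕ) {p : ℝ → ℂ} (hp : StronglyMeasurable p) :
    AEStronglyMeasurable (tailAverage m p) μ01 := by
  have h : StronglyMeasurable fun x : ℝ => (x : ℂ) ^ m *
      ∫ t, (if x < t then p t / (t : ℂ) ^ (m + 1) else 0) ∂μ01 := by
    refine StronglyMeasurable.mul (Measurable.stronglyMeasurable (by fun_prop)) ?_
    refine StronglyMeasurable.integral_prod_right (f := fun x t : ℝ =>
      if x < t then p t / (t : ℂ) ^ (m + 1) else 0) ?_
    refine Measurable.stronglyMeasurable ?_
    have := hp.measurable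
    exact Measurable.ite (measurableSet_lt measurable_fst measurable_snd) (by fun_prop)
      (by fun_prop)
  refine h.aestronglyMeasurable.congr ?_
  filter_upwards [ae_restrict_mem measurableSet_Ioo] with x hx
  rw [tail_eq hx.2]
  congr 1
  have : (fun t : ℝ => if x < t then p t / (t : ℂ) ^ (m + 1) else 0) =
      (Ioi x).indicator fun t => p t / (t : ℂ) ^ (m + 1) := by
    ext t; simp [indicator]
  rw [this, integral_indicator measurableSet_Ioi, Measure.restrict_restrict measurableSet_Ioi]
  have : Ioi x ∩ Ioo 0 1 = Ioo x 1 := by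
    ext t; simp only [mem_inter_iff, mem_Ioi, mem_Ioo]
    exact ⟨fun h => ⟨h.1, h.2.2⟩, fun h => ⟨h.1, hx.1.trans h.1, h.2⟩⟩
  rw [this]

lemma tail_eLpNorm (m : ℕ) (p : L2C) :
    eLpNorm (tailAverage m p) 2 μ01 ≤ 2 * eLpNorm p 2 μ01 := by
  have hsq : eLpNorm (tailAverage m p) 2 μ01 ^ 2 ≤ (2 * eLpNorm p 2 μ01) ^ 2 := by
    rw [mul_pow]
    have e (f : ℝ → ℂ) : eLpNorm f 2 μ01 ^ 2 = ∫⁻ x in Ioo (0:ℝ) 1, ‖f x‖ₑ ^ 2 := by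
      have := eLpNorm_nnreal_pow_eq_lintegral (μ := μ01) (f := f) (p := 2) two_ne_zero
      have h3 : ((2 : NNReal) : ℝ) = ((2 : ℕ) : ℝ) := rfl
      rw [h3] at this
      simp only [ENNReal.rpow_natCast] at this
      exact this
    rw [e, e]
    refine (setLIntegral_mono' measurableSet_Ioo fun x hx =>
      pow_le_pow_left' (enorm_tail_le hx) 2).trans ?_
    refine (hardy (fun t => ‖p t‖ₑ) (Lp.stronglyMeasurable p).enorm).trans (le_of_eq ?_)
    norm_num
  exact (ENNReal.pow_le_pow_left_iff two_ne_zero).1 hsq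

lemma tail_memLp (m : ℕ) (p : L2C) : MemLp (tailAverage m p) 2 μ01 :=
  ⟨tail_aesm m (Lp.stronglyMeasurable p),
    (tail_eLpNorm m p).trans_lt (ENNReal.mul_lt_top (by norm_num) (Lp.memLp p).2)⟩

/-- `tailAverage m` as a bounded operator of `L²(0,1)`. -/
def tailOp (m : ℕ) : L2C →L[ℂ] L2C :=
  LinearMap.mkContinuous
    { toFun := fun p => (tail_memLp m p).toLp (tailAverage m p)
      map_add' := by
        intro p q
        rw [← MemLp.toLp_add, MemLp.toLp_eq_toLp_iff]
        filter_upwards [ae_restrict_mem measurableSet_Ioo] with x hx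
        rw [Pi.add_apply, ← tail_add (Lp.memLp p) (Lp.memLp q) hx]
        exact tail_congr (Lp.coeFn_add p q) hx
      map_smul' := by
        intro c p
        rw [RingHom.id_apply, ← MemLp.toLp_const_smul, MemLp.toLp_eq_toLp_iff]
        filter_upwards [ae_restrict_mem measurableSet_Ioo] with x hx
        rw [Pi.smul_apply, smul_eq_mul, ← tail_smul]
        exact tail_congr (Lp.coeFn_smul c p) hx }
    2 (by
      intro p
      change ‖(tail_memLp m p).toLp (tailAverage m p)‖ ≤ _
      rw [Lp.norm_toLp (tailAverage m p) (tail_memLp m p), Lp.norm_def]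
      have := ENNReal.toReal_mono (ENNReal.mul_ne_top (by norm_num) (Lp.memLp p).2.ne)
        (tail_eLpNorm m p)
      simpa using this)

lemma tailOp_ae (m : ℕ) (p : L2C) : tailOp m p =ᵐ[μ01] tailAverage m p :=
  MemLp.coeFn_toLp (tail_memLp m p)

/-! ### The operators `S_a`, `T_a`, `B_a` -/

/-- First component of `S_a`: `S_0` is the identity, and
`S_{a+1}` sends `p` to `p(x) - 2(2a+1) x^{2a} ∫_x^1 p(t) / t^{2a+1} dt`. -/
def S₁ : ℕ → (L2C →L[ℂ] L2C)
  | 0 => ContinuousLinearMap.id ℂ L2C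
  | a + 1 => ContinuousLinearMap.id ℂ L2C - (2 * (2 * (a : ℂ) + 1)) • tailOp (2 * a)

/-- Second component of `S_a`: `S_0` is the identity, and
`S_{a+1}` sends `q` to `q(x) - 2(2a+1) x^{2a+1} ∫_x^1 q(t) / t^{2a+2} dt`. -/
def S₂ : ℕ → (L2C →L[ℂ] L2C)
  | 0 => ContinuousLinearMap.id ℂ L2C
  | a + 1 => ContinuousLinearMap.id ℂ L2C - (2 * (2 * (a : ℂ) + 1)) • tailOp (2 * a + 1)

lemma S₁_succ_ae (a : ℕ) (p : L2C) : ∀ᵐ x ∂μ01, S₁ (a + 1) p x =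
    p x - 2 * (2 * a + 1) * (x : ℂ) ^ (2 * a) * ∫ t in x..1, p t / (t : ℂ) ^ (2 * a + 1) := by
  have h : S₁ (a + 1) p = p - (2 * (2 * (a : ℂ) + 1)) • tailOp (2 * a) p := rfl
  rw [h]
  filter_upwards [Lp.coeFn_sub p ((2 * (2 * (a : ℂ) + 1)) • tailOp (2 * a) p),
    Lp.coeFn_smul (2 * (2 * (a : ℂ) + 1)) (tailOp (2 * a) p), tailOp_ae (2 * a) p]
    with x h1 h2 h3
  rw [h1, Pi.sub_apply, h2, Pi.smul_apply, h3, tailAverage, smul_eq_mul, mul_assoc _ (_ ^ _)]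

lemma S₂_succ_ae (a : ℕ) (q : L2C) : ∀ᵐ x ∂μ01, S₂ (a + 1) q x =
    q x - 2 * (2 * a + 1) * (x : ℂ) ^ (2 * a + 1) *
      ∫ t in x..1, q t / (t : ℂ) ^ (2 * a + 2) := by
  have h : S₂ (a + 1) q = q - (2 * (2 * (a : ℂ) + 1)) • tailOp (2 * a + 1) q := rfl
  rw [h]
  filter_upwards [Lp.coeFn_sub q ((2 * (2 * (a : ℂ) + 1)) • tailOp (2 * a + 1) q),
    Lp.coeFn_smul (2 * (2 * (a : ℂ) + 1)) (tailOp (2 * a + 1) q), tailOp_ae (2 * a + 1) q]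
    with x h1 h2 h3
  rw [h1, Pi.sub_apply, h2, Pi.smul_apply, h3, tailAverage, smul_eq_mul, mul_assoc _ (_ ^ _)]

/-- The operator `S_a[p, q] = (S₁ p, S₂ q)`. -/
def S (a : ℕ) : H →L[ℂ] H := diagOp (S₁ a) (S₂ a)

/-- The composition `A a ∘ ⋯ ∘ A 1` of a sequence of operators, read as `A 0` for `a = 0`. -/
def compDown {E : Type} [NormedAddCommGroup E] [NormedSpace ℂ E] (A : ℕ → (E →L[ℂ] E)) :
    ℕ → (E →L[ℂ] E)
  | 0 => A 0
  | 1 => A 1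
  | a + 2 => A (a + 2) ∘L compDown A (a + 1)

/-- `T_a = (-1)^{a+1} S_a ⋯ S_1` and `T_0 = -S_0`. -/
def T (a : ℕ) : H →L[ℂ] H := (-1 : ℂ) ^ (a + 1) • compDown S a

/-- First component of `T_a`. -/
def T₁ (a : ℕ) : L2C →L[ℂ] L2C := (-1 : ℂ) ^ (a + 1) • compDown S₁ a

/-- Second component of `T_a`. -/
def T₂ (a : ℕ) : L2C →L[ℂ] L2C := (-1 : ℂ) ^ (a + 1) • compDown S₂ a

/-- `B_a[f, g] = (T₂* f, T₁* g)`. -/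
def B (a : ℕ) : H →L[ℂ] H :=
  diagOp (ContinuousLinearMap.adjoint (T₂ a)) (ContinuousLinearMap.adjoint (T₁ a))

/-- `N_k`, the kernel of the adjoint of `S_k`. -/
def N (k : ℕ) : Submodule ℂ H := (ContinuousLinearMap.adjoint (S k)).ker

/-! ### Bessel functions -/

/-- The Bessel function of the first kind `J_ν(z)` (principal branch), for `z ≠ 0`. -/
def besselJ (ν z : ℂ) : ℂ :=
  ∑' m : ℕ, (-1 : ℂ) ^ m / ((m.factorial : ℂ) * Complex.Gamma (m + ν + 1)) *
    (z / 2) ^ (2 * (m : ℂ) + ν)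

/-- The spherical Bessel function `j_n(z) = √(πz/2) J_{n+1/2}(z)`, for `z ≠ 0`. -/
def sphJ (n : ℤ) (z : ℂ) : ℂ :=
  ((Real.pi : ℂ) * z / 2) ^ (1 / 2 : ℂ) * besselJ (n + 1 / 2) z

/-- The spherical Bessel function `η_n(z) = (-1)^n √(πz/2) J_{-n-1/2}(z)`, for `z ≠ 0`. -/
def sphEta (n : ℤ) (z : ℂ) : ℂ :=
  (-1 : ℂ) ^ n * ((Real.pi : ℂ) * z / 2) ^ (1 / 2 : ℂ) * besselJ (-n - 1 / 2) z

/-- Replace the value of `f` at `0` by its limit at `0`. -/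
def extendZero (f : ℂ → Fin 2 → ℂ) (z : ℂ) : Fin 2 → ℂ :=
  if z = 0 then limUnder (𝓝[≠] (0 : ℂ)) f else f z

/-- `Φ_a`, extended continuously to `z = 0`. -/
def Phi (a : ℕ) : ℂ → Fin 2 → ℂ := extendZero fun z =>
  ![-2 * sphJ ((a : ℤ) - 1) z * sphJ a z, sphJ a z ^ 2 - sphJ ((a : ℤ) - 1) z ^ 2]

/-- `Ψ_a`, extended continuously to `z = 0`. -/
def Psi (a : ℕ) : ℂ → Fin 2 → ℂ := extendZero fun z =>
  ![-sphEta ((a : ℤ) - 1) z * sphJ a z - sphEta a z * sphJ ((a : ℤ) - 1) z,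
    -sphEta ((a : ℤ) - 1) z * sphJ ((a : ℤ) - 1) z + sphEta a z * sphJ a z]

/-! ### Trigonometric vectors -/

lemma memLp_of_continuous {f : ℝ → ℂ} (hf : Continuous f) : MemLp f 2 μ01 := by
  obtain ⟨C, hC⟩ := isCompact_Icc.exists_bound_of_continuousOn (s := Icc (0:ℝ) 1) hf.continuousOn
  refine MemLp.of_bound hf.aestronglyMeasurable C ?_
  filter_upwards [ae_restrict_mem measurableSet_Ioo] with x hx
  exact hC x (Ioo_subset_Icc_self hx)

/-- The class in `L²(0,1)` of a continuous function. -/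
def ofCont (f : ℝ → ℂ) (hf : Continuous f) : L2C := (memLp_of_continuous hf).toLp f

/-- `x ↦ (sin 2λx, cos 2λx)` as an element of `L²(0,1) × L²(0,1)`. -/
def sinCos (l : ℂ) : H :=
  vec (ofCont (fun x => Complex.sin (2 * l * x)) (by fun_prop))
    (ofCont (fun x => Complex.cos (2 * l * x)) (by fun_prop))

/-- `x ↦ (cos 2λx, -sin 2λx)` as an element of `L²(0,1) × L²(0,1)`. -/
def cosNegSin (l : ℂ) : H :=
  vec (ofCont (fun x => Complex.cos (2 * l * x)) (by fun_prop))
    (ofCont (fun x => -Complex.sin (2 * l * x)) (by fun_prop))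

end

end AKNS

/-!
The adjoint of `tailOp m` is the averaging operator `f ↦ x^{-(m+1)} ∫₀ˣ t^m f(t) dt`, which has
every monomial `x ^ k` as an eigenvector, with eigenvalue `1 / (m + k + 1)`. Monomials span a dense
subspace, so the algebraic relations between the adjoints of the `S a` are identities between
rational numbers: they commute, the components satisfy `S₂* S₁ = 1`, whence `B a` is a left inverse
of `T a`, and each `S b*` acts as a nonzero scalar on the kernel `N a` when `a ≠ b`, so that the
`N a` are independent and add up to the kernel of `T a*`.

The Bessel recurrences give `(z^{2a+1} (Φ_a + Φ_{a+1}))' = 2(2a+1) z^{2a} Φ_a` for the first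
components and a similar equation for the second ones. In integrated form this is
`S_{a+1}* Φ_a(λ·) = -Φ_{a+1}(λ·)`, and induction from `Φ_0(z) = -(sin 2z, cos 2z)` gives the action
of `T a*` on trigonometric vectors. Since `Φ_a` commutes with complex conjugation, pairing with
an element of `L² × L²` turns this into the bilinear integral transforms. The same holds for `Ψ_a`.
-/

namespace AKNS

open ContinuousLinearMap (adjoint)
open scoped ComplexConjugate

noncomputable section

/-! ### A measure on an interval is determined by its moments -/

section Moments

variable {E : Type*} [NormedAddCommGroup E] [NormedSpace ℝ E] {a b : ℝ} {μ : Measure ℝ}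
  {g : ℝ → E}

lemma integrable_continuous_smul (hμ : ∀ᵐ x ∂μ, x ∈ Icc a b) (hg : Integrable g μ)
    {φ : ℝ → ℝ} (hφ : Continuous φ) : Integrable (fun x => φ x • g x) μ := by
  obtain ⟨C, hC⟩ := isCompact_Icc.exists_bound_of_continuousOn (s := Icc a b) hφ.continuousOn
  exact hg.bdd_smul C hφ.aestronglyMeasurable (hμ.mono fun x hx => hC x hx)

lemma integral_polynomial_smul_eq_zero (hμ : ∀ᵐ x ∂μ, x ∈ Icc a b) (hg : Integrable g μ)
    (h : ∀ n : ℕ, ∫ x, x ^ n • g x ∂μ = 0) (p : Polynomial ℝ) :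
    ∫ x, p.eval x • g x ∂μ = 0 := by
  induction p using Polynomial.induction_on' with
  | add p q hp hq =>
    simp only [Polynomial.eval_add, add_smul]
    rw [integral_add (integrable_continuous_smul hμ hg p.continuous)
      (integrable_continuous_smul hμ hg q.continuous), hp, hq, add_zero]
  | monomial n c =>
    simp only [Polynomial.eval_monomial, mul_smul]
    rw [integral_smul, h, smul_zero]

lemma integral_continuous_smul_eq_zero (hμ : ∀ᵐ x ∂μ, x ∈ Icc a b) (hg : Integrable g μ)
    (h : ∀ n : ℕ, ∫ x, x ^ n • g x ∂μ = 0) {φ : ℝ → ℝ} (hφ : Continuous φ) :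
    ∫ x, φ x • g x ∂μ = 0 := by
  have norm_le : ∀ ε > 0, ‖∫ x, φ x • g x ∂μ‖ ≤ ε * ∫ x, ‖g x‖ ∂μ := by
    intro ε hε
    obtain ⟨p, hp⟩ := exists_polynomial_near_of_continuousOn a b φ hφ.continuousOn ε hε
    have sub_polynomial : ∫ x, φ x • g x ∂μ = ∫ x, (φ x - p.eval x) • g x ∂μ := by
      simp only [sub_smul]
      rw [integral_sub (integrable_continuous_smul hμ hg hφ)
        (integrable_continuous_smul hμ hg p.continuous),
        integral_polynomial_smul_eq_zero hμ hg h, sub_zero]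
    rw [sub_polynomial, ← integral_const_mul]
    refine norm_integral_le_of_norm_le (hg.norm.const_mul ε) (hμ.mono fun x hx => ?_)
    rw [norm_smul, norm_sub_rev]
    gcongr
    exact (hp x hx).le
  have tendsto_zero : Tendsto (fun ε : ℝ => ε * ∫ x, ‖g x‖ ∂μ) (𝓝[>] 0) (𝓝 0) :=
    ((continuous_mul_const (∫ x, ‖g x‖ ∂μ)).tendsto' 0 0 (zero_mul _)).mono_left
      nhdsWithin_le_nhds
  exact norm_le_zero_iff.1 (ge_of_tendsto tendsto_zero (eventually_mem_nhdsWithin.mono norm_le))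

theorem ae_eq_zero_of_forall_integral_pow_smul_eq_zero [CompleteSpace E]
    (hμ : ∀ᵐ x ∂μ, x ∈ Icc a b) (hg : Integrable g μ)
    (h : ∀ n : ℕ, ∫ x, x ^ n • g x ∂μ = 0) : ∀ᵐ x ∂μ, g x = 0 :=
  ae_eq_zero_of_integral_contDiff_smul_eq_zero hg.locallyIntegrable
    fun _ hφ _ => integral_continuous_smul_eq_zero hμ hg h hφ.continuous

end Moments

/-! ### Monomials in `L²(0,1)` -/

lemma ofCont_ae (f : ℝ → ℂ) (hf : Continuous f) : ofCont f hf =ᵐ[μ01] f :=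
  MemLp.coeFn_toLp _

lemma ofCont_sub {f g : ℝ → ℂ} (hf : Continuous f) (hg : Continuous g) :
    ofCont (fun x => f x - g x) (hf.sub hg) = ofCont f hf - ofCont g hg :=
  MemLp.toLp_sub _ _

lemma ofCont_const_mul (c : ℂ) {f : ℝ → ℂ} (hf : Continuous f) :
    ofCont (fun x => c * f x) (hf.const_mul c) = c • ofCont f hf :=
  MemLp.toLp_const_smul c (memLp_of_continuous hf)

lemma inner_ofCont (f : ℝ → ℂ) (hf : Continuous f) (F : L2C) :
    inner ℂ (ofCont f hf) F = ∫ x, conj (f x) * F x ∂μ01 := by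
  rw [L2.inner_def]
  refine integral_congr_ae ?_
  filter_upwards [ofCont_ae f hf] with x hx
  rw [hx, RCLike.inner_apply']

lemma integral_μ01 (f : ℝ → ℂ) : ∫ x, f x ∂μ01 = ∫ x in (0 : ℝ)..1, f x := by
  rw [intervalIntegral.integral_of_le zero_le_one, integral_Ioc_eq_integral_Ioo]

/-- The monomial `x ^ k` as an element of `L²(0,1)`. -/
def monomial (k : ℕ) : L2C := ofCont (fun x => (x : ℂ) ^ k) (by fun_prop)

lemma inner_monomial (k : ℕ) (f : L2C) :
    inner ℂ (monomial k) f = ∫ x, (x : ℂ) ^ k * f x ∂μ01 := by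
  simp only [monomial, inner_ofCont, map_pow, Complex.conj_ofReal]

lemma inner_monomial_ofCont (k : ℕ) (f : ℝ → ℂ) (hf : Continuous f) :
    inner ℂ (monomial k) (ofCont f hf) = ∫ x in (0 : ℝ)..1, (x : ℂ) ^ k * f x := by
  rw [inner_monomial, ← integral_μ01]
  refine integral_congr_ae ?_
  filter_upwards [ofCont_ae f hf] with x hx
  rw [hx]

lemma eq_zero_of_forall_inner_monomial_eq_zero {K : ℕ} {f : L2C}
    (h : ∀ k, K ≤ k → inner ℂ (monomial k) f = 0) : f = 0 := by
  have integrable_pow_mul : Integrable (fun x : ℝ => (x : ℂ) ^ K * f x) μ01 :=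
    (memLp_of_continuous (f := fun x : ℝ => (x : ℂ) ^ K) (by fun_prop)).integrable_mul
      (Lp.memLp f)
  have moments (n : ℕ) : ∫ x : ℝ, x ^ n • ((x : ℂ) ^ K * f x) ∂μ01 = 0 := by
    rw [← h (K + n) le_self_add, inner_monomial]
    congr with x
    rw [Complex.real_smul, Complex.ofReal_pow, pow_add]
    ring
  rw [Lp.eq_zero_iff_ae_eq_zero]
  filter_upwards [ae_restrict_mem measurableSet_Ioo,
    ae_eq_zero_of_forall_integral_pow_smul_eq_zero
      ((ae_restrict_mem measurableSet_Ioo).mono fun x hx => Ioo_subset_Icc_self hx)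
      integrable_pow_mul moments] with x hx hfx
  exact (mul_eq_zero.1 hfx).resolve_left (pow_ne_zero K (Complex.ofReal_ne_zero.2 hx.1.ne'))

lemma ext_inner_monomial {K : ℕ} {f g : L2C}
    (h : ∀ k, K ≤ k → inner ℂ (monomial k) f = inner ℂ (monomial k) g) : f = g := by
  refine sub_eq_zero.1 (eq_zero_of_forall_inner_monomial_eq_zero (K := K) fun k hk => ?_)
  rw [inner_sub_right, h k hk, sub_self]

lemma clm_ext_monomial (K : ℕ) {A B : L2C →L[ℂ] L2C}
    (h : ∀ k, K ≤ k → A (monomial k) = B (monomial k)) : A = B := by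
  refine adjoint.injective (ContinuousLinearMap.ext fun f =>
    ext_inner_monomial (K := K) fun k hk => ?_)
  rw [ContinuousLinearMap.adjoint_inner_right, ContinuousLinearMap.adjoint_inner_right, h k hk]

/-! ### Tail averages and Hardy averages -/

lemma integral_ofReal_pow (x y : ℝ) (n : ℕ) :
    ∫ t in x..y, (t : ℂ) ^ n = ((y : ℂ) ^ (n + 1) - (x : ℂ) ^ (n + 1)) / (n + 1) := by
  simp only [← Complex.ofReal_pow, intervalIntegral.integral_ofReal, integral_pow]
  push_cast
  rfl

lemma tailAverage_pow (m j : ℕ) {x : ℝ} (hx : x ∈ Ioo (0 : ℝ) 1) :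
    tailAverage m (fun t => (t : ℂ) ^ (m + 1 + j)) x =
      ((j : ℂ) + 1)⁻¹ * ((x : ℂ) ^ m - (x : ℂ) ^ (m + 1 + j)) := by
  have cancel : ∫ t in x..1, (t : ℂ) ^ (m + 1 + j) / (t : ℂ) ^ (m + 1) =
      ∫ t in x..1, (t : ℂ) ^ j := by
    refine intervalIntegral.integral_congr fun t ht => ?_
    rw [uIcc_of_le hx.2.le] at ht
    have ht0 : (t : ℂ) ≠ 0 := Complex.ofReal_ne_zero.2 (hx.1.trans_le ht.1).ne'
    simp only [pow_add (t : ℂ) (m + 1), mul_div_cancel_left₀ _ (pow_ne_zero _ ht0)]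
  rw [tailAverage, cancel, integral_ofReal_pow, Complex.ofReal_one, one_pow, div_eq_inv_mul]
  ring

lemma tailOp_monomial (m j : ℕ) :
    tailOp m (monomial (m + 1 + j)) =
      ((j : ℂ) + 1)⁻¹ • (monomial m - monomial (m + 1 + j)) := by
  simp only [monomial]
  rw [← ofCont_sub, ← ofCont_const_mul]
  refine Lp.ext ?_
  filter_upwards [tailOp_ae m (ofCont (fun x => (x : ℂ) ^ (m + 1 + j)) (by fun_prop)),
    ofCont_ae (fun x : ℝ => ((j : ℂ) + 1)⁻¹ * ((x : ℂ) ^ m - (x : ℂ) ^ (m + 1 + j)))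
      (by fun_prop), ae_restrict_mem measurableSet_Ioo] with x h_tail h_right hx
  rw [h_tail, h_right, tail_congr (ofCont_ae _ _) hx, tailAverage_pow m j hx]

/-- The adjoint of `tailOp m`. It is the Hardy averaging operator
`f ↦ x ^ (-(m + 1)) * ∫_0^x t ^ m f(t) dt`, see `hardyOp_ofCont`. -/
def hardyOp (m : ℕ) : L2C →L[ℂ] L2C := adjoint (tailOp m)

lemma integral_pow_mul_primitive {F : ℝ → ℂ} (hF : Continuous F) (j : ℕ) :
    ((j : ℂ) + 1) * ∫ t in (0 : ℝ)..1, (t : ℂ) ^ j * ∫ x in (0 : ℝ)..t, F x =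
      ∫ t in (0 : ℝ)..1, (1 - (t : ℂ) ^ (j + 1)) * F t := by
  have hasDerivAt_pow (t : ℝ) :
      HasDerivAt (fun t : ℝ => (t : ℂ) ^ (j + 1) - 1) (((j : ℂ) + 1) * (t : ℂ) ^ j) t := by
    simpa using (((hasDerivAt_id (t : ℂ)).pow (j + 1)).comp_ofReal).sub_const 1
  have hasDerivAt_primitive (t : ℝ) : HasDerivAt (fun t => ∫ x in (0 : ℝ)..t, F x) (F t) t :=
    (hF.integral_hasStrictDerivAt 0 t).hasDerivAt
  have by_parts := intervalIntegral.integral_mul_deriv_eq_deriv_mul (a := 0) (b := 1)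
    (fun t _ => hasDerivAt_pow t) (fun t _ => hasDerivAt_primitive t)
    (Continuous.intervalIntegrable (by fun_prop) _ _) (hF.intervalIntegrable _ _)
  simp only [Complex.ofReal_one, one_pow, sub_self, zero_mul, intervalIntegral.integral_same,
    mul_zero, zero_sub, mul_assoc, intervalIntegral.integral_const_mul] at by_parts
  rw [← neg_eq_iff_eq_neg.2 by_parts, ← intervalIntegral.integral_neg]
  refine intervalIntegral.integral_congr fun t _ => ?_
  ring

lemma hardyOp_ofCont {m : ℕ} {f g : ℝ → ℂ} (hf : Continuous f) (hg : Continuous g)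
    (h : ∀ t ∈ Ioc (0 : ℝ) 1, (t : ℂ) ^ (m + 1) * g t = ∫ x in (0 : ℝ)..t, (x : ℂ) ^ m * f x) :
    hardyOp m (ofCont f hf) = ofCont g hg := by
  refine ext_inner_monomial (K := m + 1) fun k hk => ?_
  obtain ⟨j, rfl⟩ := Nat.exists_eq_add_of_le hk
  calc inner ℂ (monomial (m + 1 + j)) (hardyOp m (ofCont f hf))
    _ = ((j : ℂ) + 1)⁻¹ * ((∫ x in (0 : ℝ)..1, (x : ℂ) ^ m * f x) -
          ∫ x in (0 : ℝ)..1, (x : ℂ) ^ (m + 1 + j) * f x) := by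
      rw [hardyOp, ContinuousLinearMap.adjoint_inner_right, tailOp_monomial, inner_smul_left,
        inner_sub_left, inner_monomial_ofCont, inner_monomial_ofCont, map_inv₀, map_add,
        Complex.conj_natCast, map_one]
    _ = ((j : ℂ) + 1)⁻¹ * ∫ x in (0 : ℝ)..1, (1 - (x : ℂ) ^ (j + 1)) * ((x : ℂ) ^ m * f x) := by
      rw [← intervalIntegral.integral_sub (Continuous.intervalIntegrable (by fun_prop) _ _)
        (Continuous.intervalIntegrable (by fun_prop) _ _)]
      congr 1
      refine intervalIntegral.integral_congr fun x _ => ?_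
      ring
    _ = ∫ t in (0 : ℝ)..1, (t : ℂ) ^ j * ∫ x in (0 : ℝ)..t, (x : ℂ) ^ m * f x := by
      rw [← integral_pow_mul_primitive (by fun_prop),
        inv_mul_cancel_left₀ (Nat.cast_add_one_ne_zero j)]
    _ = ∫ t in (0 : ℝ)..1, (t : ℂ) ^ (m + 1 + j) * g t := by
      refine intervalIntegral.integral_congr_uIoo fun t ht => ?_
      rw [uIoo_of_le zero_le_one] at ht
      simp only [← h t (Ioo_subset_Ioc_self ht)]
      ring
    _ = inner ℂ (monomial (m + 1 + j)) (ofCont g hg) := (inner_monomial_ofCont _ _ _).symm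

lemma natCast_add_add_one_ne_zero (m n : ℕ) : (m : ℂ) + n + 1 ≠ 0 := by
  exact_mod_cast (m + n).succ_ne_zero

lemma hardyOp_monomial (m k : ℕ) :
    hardyOp m (monomial k) = ((m : ℂ) + k + 1)⁻¹ • monomial k := by
  rw [monomial, ← ofCont_const_mul]
  refine hardyOp_ofCont _ _ fun t _ => ?_
  simp only [← pow_add, integral_ofReal_pow, Complex.ofReal_zero, zero_pow (m + k).succ_ne_zero]
  push_cast
  ring

lemma hardyOp_sub_hardyOp (m n : ℕ) :
    hardyOp m - hardyOp n = ((n : ℂ) - m) • (hardyOp m * hardyOp n) := by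
  refine clm_ext_monomial 0 fun k _ => ?_
  have hm := natCast_add_add_one_ne_zero m k
  have hn := natCast_add_add_one_ne_zero n k
  simp only [_root_.sub_apply, _root_.smul_apply, mul_apply_eq_comp,
    hardyOp_monomial, map_smul, smul_smul, ← sub_smul]
  congr 1
  field_simp
  ring

lemma commute_hardyOp (m n : ℕ) : Commute (hardyOp m) (hardyOp n) := by
  refine clm_ext_monomial 0 fun k _ => ?_
  simp only [mul_apply_eq_comp, hardyOp_monomial, map_smul, smul_smul, mul_comm]

lemma smul_hardyOp_mul_tailOp (m n : ℕ) :
    ((m : ℂ) + n + 1) • (hardyOp n * tailOp m) = hardyOp n + tailOp m := by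
  refine clm_ext_monomial (m + 1) fun k hk => ?_
  obtain ⟨j, rfl⟩ := Nat.exists_eq_add_of_le hk
  have hm := natCast_add_add_one_ne_zero n m
  have hk := natCast_add_add_one_ne_zero n (m + 1 + j)
  have hj : (j : ℂ) + 1 ≠ 0 := Nat.cast_add_one_ne_zero j
  simp only [_root_.add_apply, _root_.smul_apply, mul_apply_eq_comp,
    tailOp_monomial, hardyOp_monomial, map_smul, map_sub, smul_sub, smul_smul]
  push_cast at hk ⊢
  match_scalars
  · field_simp
    ring
  · field_simp
    ring

lemma smul_hardyOp_eq_self {m s : ℕ} {f : L2C} (h : ((m : ℂ) + s + 1) • hardyOp m f = f)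
    (k : ℕ) : ((k : ℂ) + s + 1) • hardyOp k f = f := by
  have resolvent : hardyOp k f - hardyOp m f = ((m : ℂ) - k) • hardyOp k (hardyOp m f) :=
    congr($(hardyOp_sub_hardyOp k m) f)
  have image : ((m : ℂ) + s + 1) • hardyOp k (hardyOp m f) = hardyOp k f := by
    rw [← map_smul, h]
  linear_combination (norm := module)
    ((m : ℂ) + s + 1) • resolvent + ((m : ℂ) - k) • image + h

/-- The operator `1 - (m + n + 1) • tailOp m`. The constant is chosen so that swapping `m` and `n`
and taking the adjoint gives a left inverse, see `adjoint_tailShift_mul_tailShift`. -/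
def tailShift (m n : ℕ) : L2C →L[ℂ] L2C := 1 - ((m : ℂ) + n + 1) • tailOp m

lemma adjoint_tailShift (m n : ℕ) :
    adjoint (tailShift m n) = 1 - ((m : ℂ) + n + 1) • hardyOp m := by
  simp only [tailShift, hardyOp, ← ContinuousLinearMap.star_eq_adjoint, star_sub, star_one,
    star_smul, star_add, star_natCast]

lemma adjoint_tailShift_mul_tailShift (m n : ℕ) :
    adjoint (tailShift n m) * tailShift m n = 1 := by
  have hardy_tail := smul_hardyOp_mul_tailOp m n
  rw [adjoint_tailShift, tailShift, sub_mul, mul_sub, mul_sub, one_mul, one_mul, mul_one,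
    smul_mul_smul_comm, add_comm (n : ℂ) m, mul_smul, hardy_tail]
  module

lemma commute_tailShift (m n p q : ℕ) : Commute (tailShift m n) (tailShift p q) := by
  have commute_tailOp : Commute (tailOp m) (tailOp p) :=
    commute_star_star.1 (commute_hardyOp m p)
  exact (Commute.one_left _).sub_left
    (((Commute.one_right _).sub_right (commute_tailOp.smul_right _)).smul_left _)

lemma smul_adjoint_tailShift_of_eq_zero {m n : ℕ} {f : L2C}
    (hf : adjoint (tailShift m n) f = 0) (p q : ℕ) :
    ((p : ℂ) + n + 1) • adjoint (tailShift p q) f = ((n : ℂ) - q) • f := by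
  rw [adjoint_tailShift] at hf
  have hardyOp_p := smul_hardyOp_eq_self (sub_eq_zero.1 hf).symm p
  rw [adjoint_tailShift, _root_.sub_apply, _root_.smul_apply, one_apply_eq_self]
  linear_combination (norm := module) (-((p : ℂ) + q + 1)) • hardyOp_p

lemma S₁_succ (a : ℕ) : S₁ (a + 1) = tailShift (2 * a) (2 * a + 1) := by
  rw [S₁, tailShift]
  push_cast
  ring_nf
  rfl

lemma S₂_succ (a : ℕ) : S₂ (a + 1) = tailShift (2 * a + 1) (2 * a) := by
  rw [S₂, tailShift]
  push_cast
  ring_nf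
  rfl

lemma adjoint_S₂_mul_S₁ (k : ℕ) : adjoint (S₂ k) * S₁ k = 1 := by
  cases k with
  | zero => rw [S₁, S₂, ContinuousLinearMap.adjoint_id]; rfl
  | succ a => rw [S₁_succ, S₂_succ, adjoint_tailShift_mul_tailShift]

/-! ### Compositions of sequences of operators -/

section Composition

variable {E : Type} [NormedAddCommGroup E]

lemma compDown_succ [NormedSpace ℂ E] {A : ℕ → E →L[ℂ] E} (h₀ : A 0 = 1) (a : ℕ) :
    compDown A (a + 1) = A (a + 1) * compDown A a := by
  cases a with
  | zero => rw [compDown, compDown, h₀, mul_one]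
  | succ a => rfl

lemma commute_compDown [NormedSpace ℂ E] {A : ℕ → E →L[ℂ] E} {B : E →L[ℂ] E}
    (h : ∀ k, Commute B (A k)) : ∀ a, Commute B (compDown A a)
  | 0 => h 0
  | 1 => h 1
  | a + 2 => (h (a + 2)).mul_right (commute_compDown h (a + 1))

lemma ker_mul_of_commute [NormedSpace ℂ E] {A B : E →L[ℂ] E} (h : Commute A B)
    (hker : A.ker ≤ A.ker.map B.toLinearMap) : (A * B).ker = A.ker ⊔ B.ker := by
  refine le_antisymm ?_ (sup_le ?_ (LinearMap.ker_le_ker_comp _ _))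
  · rw [← Submodule.comap_map_eq]
    exact fun _ hx => hker hx
  · rw [h.eq]
    exact LinearMap.ker_le_ker_comp _ _

lemma ker_compDown [NormedSpace ℂ E] {A : ℕ → E →L[ℂ] E} (h₀ : A 0 = 1)
    (hcomm : ∀ i j, Commute (A i) (A j))
    (hker : ∀ i j, 0 < i → i < j → (A i).ker ≤ (A i).ker.map (A j).toLinearMap) (a : ℕ) :
    (compDown A a).ker = ⨆ k ∈ Finset.Icc 1 a, (A k).ker := by
  induction a with
  | zero =>
    rw [Finset.Icc_eq_empty (by lia), compDown, h₀]
    simp only [Finset.notMem_empty, iSup_false, iSup_bot]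
    exact LinearMap.ker_id
  | succ a ih =>
    have commute_succ : Commute (A (a + 1)) (compDown A a) := commute_compDown (hcomm (a + 1)) a
    rw [compDown_succ h₀, commute_succ.eq, ker_mul_of_commute commute_succ.symm, ih,
      ← Finset.insert_Icc_right_eq_Icc_add_one (by lia), Finset.iSup_insert, sup_comm]
    simp only [ih, Submodule.map_iSup]
    refine iSup₂_mono fun k hk => ?_
    rw [Finset.mem_Icc] at hk
    exact hker k (a + 1) (by lia) (by lia)

variable [InnerProductSpace ℂ E] [CompleteSpace E]

lemma adjoint_compDown {A : ℕ → E →L[ℂ] E} (hcomm : ∀ i j, Commute (A i) (A j)) :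
    ∀ a, adjoint (compDown A a) = compDown (fun k => adjoint (A k)) a
  | 0 => rfl
  | 1 => rfl
  | a + 2 => by
    rw [compDown, compDown, ← adjoint_compDown hcomm (a + 1), ← ContinuousLinearMap.mul_def,
      (commute_compDown (hcomm (a + 2)) (a + 1)).eq]
    exact ContinuousLinearMap.adjoint_comp _ _

lemma adjoint_compDown_mul_compDown {A B : ℕ → E →L[ℂ] E} (h : ∀ k, adjoint (A k) * B k = 1) :
    ∀ a, adjoint (compDown A a) * compDown B a = 1
  | 0 => h 0
  | 1 => h 1
  | a + 2 => by
    rw [compDown, compDown, ContinuousLinearMap.adjoint_comp, ← ContinuousLinearMap.mul_def,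
      ← ContinuousLinearMap.mul_def, mul_assoc, ← mul_assoc (adjoint (A (a + 2))), h, one_mul,
      adjoint_compDown_mul_compDown h (a + 1)]

end Composition

lemma adjoint_diagOp (A B : L2C →L[ℂ] L2C) :
    adjoint (diagOp A B) = diagOp (adjoint A) (adjoint B) := by
  refine ((ContinuousLinearMap.eq_adjoint_iff _ _).2 ?_).symm
  rintro ⟨f, g⟩ ⟨f', g'⟩
  simp only [diagOp_vec, WithLp.prod_inner_apply, ContinuousLinearMap.adjoint_inner_left]

lemma diagOp_mul_diagOp (A B C D : L2C →L[ℂ] L2C) :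
    diagOp A B * diagOp C D = diagOp (A * C) (B * D) := rfl

lemma compDown_diagOp (A B : ℕ → L2C →L[ℂ] L2C) :
    ∀ a, compDown (fun k => diagOp (A k) (B k)) a = diagOp (compDown A a) (compDown B a)
  | 0 => rfl
  | 1 => rfl
  | a + 2 => by
    rw [compDown, compDown_diagOp A B (a + 1)]
    rfl

/-! ### The operators `T a` and the kernels `N k` -/

lemma T_eq_diagOp (a : ℕ) : T a = diagOp (T₁ a) (T₂ a) := by
  rw [T, show S = fun k => diagOp (S₁ k) (S₂ k) from rfl, compDown_diagOp]
  rfl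

lemma adjoint_T_vec (a : ℕ) (f g : L2C) :
    adjoint (T a) (vec f g) = vec (adjoint (T₁ a) f) (adjoint (T₂ a) g) := by
  rw [T_eq_diagOp, adjoint_diagOp, diagOp_vec]

lemma adjoint_T₂_mul_T₁ (a : ℕ) : adjoint (T₂ a) * T₁ a = 1 := by
  rw [T₁, T₂, ← ContinuousLinearMap.star_eq_adjoint, star_smul, smul_mul_smul_comm,
    ContinuousLinearMap.star_eq_adjoint, adjoint_compDown_mul_compDown adjoint_S₂_mul_S₁,
    star_pow, star_neg, star_one, ← mul_pow, neg_one_mul, neg_neg, one_pow, one_smul]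

lemma B_mul_T (a : ℕ) : B a * T a = 1 := by
  have adjoint_T₁_mul_T₂ : adjoint (T₁ a) * T₂ a = 1 := by
    simpa only [ContinuousLinearMap.star_eq_adjoint, star_mul, star_one,
      ContinuousLinearMap.adjoint_adjoint] using congr(star $(adjoint_T₂_mul_T₁ a))
  rw [B, T_eq_diagOp, diagOp_mul_diagOp, adjoint_T₂_mul_T₁, adjoint_T₁_mul_T₂]
  rfl

lemma leftInverse_B_T (a : ℕ) : Function.LeftInverse (B a) (T a) :=
  fun F => congr($(B_mul_T a) F)

lemma S_zero : S 0 = 1 := rfl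

lemma commute_S (i j : ℕ) : Commute (S i) (S j) := by
  cases i with
  | zero => exact S_zero ▸ Commute.one_left _
  | succ i =>
    cases j with
    | zero => exact S_zero ▸ Commute.one_right _
    | succ j =>
      rw [S, S, S₁_succ, S₂_succ, S₁_succ, S₂_succ, Commute, SemiconjBy, diagOp_mul_diagOp,
        diagOp_mul_diagOp, (commute_tailShift (2 * i) _ _ _).eq,
        (commute_tailShift (2 * i + 1) _ _ _).eq]

lemma adjoint_S_succ_vec (a : ℕ) (f g : L2C) :
    adjoint (S (a + 1)) (vec f g) = vec (adjoint (tailShift (2 * a) (2 * a + 1)) f)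
      (adjoint (tailShift (2 * a + 1) (2 * a)) g) := by
  rw [S, adjoint_diagOp, diagOp_vec, S₁_succ, S₂_succ]

lemma smul_adjoint_S_of_mem_N {a : ℕ} {F : H} (hF : F ∈ N (a + 1)) (b : ℕ) :
    ((a : ℂ) + b + 1) • adjoint (S (b + 1)) F = ((a : ℂ) - b) • F := by
  obtain ⟨f, g⟩ := F
  have hN : vec (adjoint (tailShift (2 * a) (2 * a + 1)) f)
      (adjoint (tailShift (2 * a + 1) (2 * a)) g) = 0 := (adjoint_S_succ_vec a f g).symm.trans hF
  have h₁ := smul_adjoint_tailShift_of_eq_zero congr(WithLp.fst $hN) (2 * b) (2 * b + 1)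
  have h₂ := smul_adjoint_tailShift_of_eq_zero congr(WithLp.snd $hN) (2 * b + 1) (2 * b)
  push_cast at h₁ h₂
  have fst_eq : ((a : ℂ) + b + 1) • adjoint (tailShift (2 * b) (2 * b + 1)) f =
      ((a : ℂ) - b) • f := by
    linear_combination (norm := module) (2⁻¹ : ℂ) • h₁
  have snd_eq : ((a : ℂ) + b + 1) • adjoint (tailShift (2 * b + 1) (2 * b)) g =
      ((a : ℂ) - b) • g := by
    linear_combination (norm := module) (2⁻¹ : ℂ) • h₂
  rw [adjoint_S_succ_vec]
  exact congrArg₂ vec fst_eq snd_eq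

lemma N_le_map_adjoint_S {i j : ℕ} (hi : 0 < i) (hij : i < j) :
    N i ≤ (N i).map (adjoint (S j)).toLinearMap := by
  obtain ⟨a, rfl⟩ := Nat.exists_eq_add_of_le' hi
  obtain ⟨b, rfl⟩ := Nat.exists_eq_add_of_le' (hi.trans hij)
  have hab : (a : ℂ) - b ≠ 0 := sub_ne_zero.2 (Nat.cast_injective.ne (by lia))
  intro F hF
  refine ⟨((a : ℂ) - b)⁻¹ • ((a : ℂ) + b + 1) • F,
    Submodule.smul_mem _ _ (Submodule.smul_mem _ _ hF), ?_⟩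
  rw [ContinuousLinearMap.coe_coe, map_smul, map_smul, smul_adjoint_S_of_mem_N hF,
    inv_smul_smul₀ hab]

lemma adjoint_S_zero : adjoint (S 0) = 1 := by
  rw [S_zero, ← ContinuousLinearMap.star_eq_adjoint, star_one]

lemma adjoint_T_eq (a : ℕ) :
    adjoint (T a) = (-1 : ℂ) ^ (a + 1) • compDown (fun k => adjoint (S k)) a := by
  rw [T, map_smulₛₗ, adjoint_compDown commute_S, map_pow, map_neg, map_one]

lemma adjoint_T_zero : adjoint (T 0) = -1 := by
  rw [adjoint_T_eq, compDown, adjoint_S_zero, zero_add, pow_one, neg_one_smul]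

lemma adjoint_T_succ (a : ℕ) : adjoint (T (a + 1)) = -(adjoint (S (a + 1)) * adjoint (T a)) := by
  rw [adjoint_T_eq, adjoint_T_eq, compDown_succ adjoint_S_zero, mul_smul_comm, pow_succ _ (a + 1),
    mul_neg_one, neg_smul]

lemma ker_adjoint_T (a : ℕ) : (adjoint (T a)).ker = ⨆ k : Finset.Icc 1 a, N k := by
  have ker_eq_ker_compDown : (adjoint (T a)).ker = (compDown (fun k => adjoint (S k)) a).ker := by
    rw [adjoint_T_eq]
    exact LinearMap.ker_smul _ _ (pow_ne_zero _ (neg_ne_zero.2 one_ne_zero))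
  rw [ker_eq_ker_compDown, ker_compDown (A := fun k => adjoint (S k)) adjoint_S_zero
    (fun i j => commute_star_star.2 (commute_S i j)) fun i j => N_le_map_adjoint_S]
  exact iSup_subtype'

lemma iSupIndep_N (a : ℕ) : iSupIndep fun k : Finset.Icc 1 a => N k := by
  have injective_eigenvalue :
      Function.Injective fun k : Finset.Icc 1 a => 1 - ((k : ℕ) : ℂ)⁻¹ := fun k l hkl =>
    Subtype.ext (Nat.cast_injective (inv_injective (sub_right_injective hkl)))
  refine ((Module.End.eigenspaces_iSupIndep (adjoint (S 1)).toLinearMap).comp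
    injective_eigenvalue).mono ?_
  rintro ⟨k, hk⟩ F hF
  obtain ⟨b, rfl⟩ := Nat.exists_eq_add_of_le' (Finset.mem_Icc.1 hk).1
  have hb : (b : ℂ) + 1 ≠ 0 := Nat.cast_add_one_ne_zero b
  have h := smul_adjoint_S_of_mem_N hF 0
  rw [Nat.cast_zero, add_zero, sub_zero, ← eq_inv_smul_iff₀ hb, smul_smul] at h
  refine Module.End.mem_eigenspace_iff.2 (h.trans ?_)
  push_cast
  congr 1
  field_simp
  ring

/-- A bounded operator `A` between Hilbert spaces with a bounded left inverse `B`, as an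
isomorphism onto the orthogonal complement of the kernel of its adjoint; its inverse is the
restriction of `B`. -/
def equivOrthogonalKerAdjoint {𝕜 E F : Type*} [RCLike 𝕜] [NormedAddCommGroup E]
    [InnerProductSpace 𝕜 E] [CompleteSpace E] [NormedAddCommGroup F] [InnerProductSpace 𝕜 F]
    [CompleteSpace F] {A : E →L[𝕜] F} {B : F →L[𝕜] E} (h : Function.LeftInverse B A) :
    E ≃L[𝕜] ((adjoint A).kerᗮ : Submodule 𝕜 F) :=
  have range_eq : A.range = (adjoint A).kerᗮ := by
    rw [ContinuousLinearMap.orthogonal_ker, ContinuousLinearMap.adjoint_adjoint]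
    exact (h.isClosedEmbedding B.continuous A.continuous).isClosed_range
      |>.submodule_topologicalClosure_eq.symm
  ContinuousLinearEquiv.equivOfInverse
    (A.codRestrict _ fun x => range_eq ▸ LinearMap.mem_range_self A.toLinearMap x)
    (B ∘L Submodule.subtypeL _) h fun ⟨y, hy⟩ => by
      rw [← range_eq] at hy
      obtain ⟨x, rfl⟩ := hy
      exact Subtype.ext (congrArg A (h x))

/-! ### The power series of the Riccati–Bessel functions -/

/-- The coefficients `(-1)^m / (m! Γ(m + n + 3/2))` of the power series of `J_{n+1/2}`. -/
def besselCoeff (n : ℤ) (m : ℕ) : ℂ :=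
  (-1 : ℂ) ^ m / ((m.factorial : ℂ) * Complex.Gamma (m + (n + 1 / 2) + 1))

/-- The entire part of `j_n`: up to the factor `√π (z/2)^(n+1)`, which carries all the branching
and the poles, `j_n(z)` is the value of this function at `(z/2)^2`, see `sphJ_eq`. -/
def besselEntire (n : ℤ) (w : ℂ) : ℂ := ∑' m : ℕ, besselCoeff n m * w ^ m

lemma intCast_add_half_ne_zero (k : ℤ) : (k : ℂ) + 1 / 2 ≠ 0 := by
  intro h
  have odd_eq_zero : (2 * k + 1 : ℂ) = 0 := by linear_combination 2 * h
  have : 2 * k + 1 = 0 := by exact_mod_cast odd_eq_zero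
  lia

lemma Gamma_add_half_add_one_ne_zero (n : ℤ) (m : ℕ) :
    Complex.Gamma (m + (n + 1 / 2) + 1) ≠ 0 := by
  refine Complex.Gamma_ne_zero fun k hk => intCast_add_half_ne_zero (m + n + 1 + k) ?_
  push_cast
  linear_combination hk

lemma besselCoeff_sub_one (n : ℤ) (m : ℕ) :
    besselCoeff (n - 1) m = (m + n + 1 / 2) * besselCoeff n m := by
  have arg_ne_zero : (m : ℂ) + n + 1 / 2 ≠ 0 := by
    exact_mod_cast intCast_add_half_ne_zero (m + n)
  have arg_sub_one : (m : ℂ) + (((n - 1 : ℤ) : ℂ) + 1 / 2) + 1 = m + n + 1 / 2 := by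
    push_cast; ring
  rw [besselCoeff, besselCoeff, arg_sub_one, ← add_assoc, Complex.Gamma_add_one _ arg_ne_zero,
    mul_div_assoc', mul_left_comm, mul_div_mul_left _ _ arg_ne_zero]

lemma add_one_mul_besselCoeff_succ (n : ℤ) (m : ℕ) :
    ((m : ℂ) + 1) * besselCoeff n (m + 1) = -besselCoeff (n + 1) m := by
  have Gamma_ne_zero := Gamma_add_half_add_one_ne_zero (n + 1) m
  have factorial_ne_zero : (m.factorial : ℂ) ≠ 0 := by exact_mod_cast m.factorial_ne_zero
  have arg_succ : ((m + 1 : ℕ) : ℂ) + ((n : ℂ) + 1 / 2) + 1 =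
      m + (((n + 1 : ℤ) : ℂ) + 1 / 2) + 1 := by push_cast; ring
  rw [besselCoeff, besselCoeff, arg_succ, Nat.factorial_succ, pow_succ]
  push_cast at Gamma_ne_zero ⊢
  have := Nat.cast_add_one_ne_zero (R := ℂ) m
  field_simp

lemma mul_besselCoeff_succ (n : ℤ) (m : ℕ) :
    ((m : ℂ) + 1) * (m + n + 3 / 2) * besselCoeff n (m + 1) = -besselCoeff n m := by
  have raise := besselCoeff_sub_one (n + 1) m
  rw [add_sub_cancel_right] at raise
  push_cast at raise
  linear_combination (m + n + 3 / 2 : ℂ) * add_one_mul_besselCoeff_succ n m + raise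

lemma summable_norm_besselCoeff_mul_pow (n : ℤ) {r : ℝ} (hr : 0 ≤ r) :
    Summable fun m => ‖besselCoeff n m‖ * r ^ m := by
  refine summable_of_ratio_norm_eventually_le (r := 1 / 2) (by norm_num) ?_
  obtain ⟨M, hM⟩ := exists_nat_ge (2 * r)
  filter_upwards [eventually_ge_atTop (max M n.natAbs)] with m hm
  have M_le : (M : ℝ) ≤ m := by exact_mod_cast (le_max_left _ _).trans hm
  have add_nonneg : (0 : ℝ) ≤ m + n := by
    exact_mod_cast (by lia : (0 : ℤ) ≤ m + n)
  have ratio : (m + 1 : ℝ) * (m + n + 3 / 2) * ‖besselCoeff n (m + 1)‖ = ‖besselCoeff n m‖ := by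
    have norm_factor : ‖((m : ℂ) + 1) * (m + n + 3 / 2)‖ = (m + 1 : ℝ) * (m + n + 3 / 2) := by
      rw [show ((m : ℂ) + 1) * (m + n + 3 / 2) = (((m + 1 : ℝ) * (m + n + 3 / 2) : ℝ) : ℂ) by
        push_cast; ring, Complex.norm_real, Real.norm_of_nonneg (by positivity)]
    rw [← norm_factor, ← norm_mul, mul_besselCoeff_succ, norm_neg]
  have two_mul_le : 2 * r ≤ (m + 1 : ℝ) * (m + n + 3 / 2) := by nlinarith
  rw [Real.norm_of_nonneg (by positivity), Real.norm_of_nonneg (by positivity), ← ratio, pow_succ]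
  have := mul_le_mul_of_nonneg_right two_mul_le
    (mul_nonneg (norm_nonneg (besselCoeff n (m + 1))) (pow_nonneg hr m))
  linarith

lemma hasSum_besselEntire (n : ℤ) (w : ℂ) :
    HasSum (fun m => besselCoeff n m * w ^ m) (besselEntire n w) := by
  refine (Summable.of_norm ?_).hasSum
  simpa only [norm_mul, norm_pow] using summable_norm_besselCoeff_mul_pow n (norm_nonneg w)

lemma continuous_besselEntire (n : ℤ) : Continuous (besselEntire n) := by
  refine continuous_iff_continuousAt.2 fun w => ?_
  refine ContinuousOn.continuousAt (s := Metric.ball 0 (‖w‖ + 1)) ?_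
    (Metric.isOpen_ball.mem_nhds (mem_ball_zero_iff.2 (lt_add_one _)))
  refine continuousOn_tsum (fun m => by fun_prop)
    (summable_norm_besselCoeff_mul_pow n (r := ‖w‖ + 1) (by positivity)) fun m z hz => ?_
  rw [norm_mul, norm_pow]
  gcongr
  exact (mem_ball_zero_iff.1 hz).le

lemma hasSum_natCast_mul_besselCoeff (n : ℤ) (w : ℂ) :
    HasSum (fun m : ℕ => (m : ℂ) * (besselCoeff n m * w ^ m)) (-(w * besselEntire (n + 1) w)) := by
  rw [← hasSum_nat_add_iff' 1]
  simp only [Finset.range_one, Finset.sum_singleton, Nat.cast_zero, zero_mul, sub_zero]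
  convert ((hasSum_besselEntire (n + 1) w).mul_left w).neg using 2 with m
  push_cast
  linear_combination w ^ (m + 1) * add_one_mul_besselCoeff_succ n m

lemma besselEntire_sub_one (n : ℤ) (w : ℂ) :
    besselEntire (n - 1) w = (n + 1 / 2) * besselEntire n w - w * besselEntire (n + 1) w := by
  have hasSum_rhs := (hasSum_natCast_mul_besselCoeff n w).add
    ((hasSum_besselEntire n w).mul_left ((n : ℂ) + 1 / 2))
  rw [sub_eq_neg_add _ (w * _), ← hasSum_rhs.tsum_eq]
  refine tsum_congr fun m => ?_
  rw [besselCoeff_sub_one]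
  ring

lemma besselEntire_conj (n : ℤ) (w : ℂ) : besselEntire n (conj w) = conj (besselEntire n w) := by
  rw [besselEntire, besselEntire, Complex.conj_tsum]
  refine tsum_congr fun m => ?_
  have arg_ofReal : (m : ℂ) + (n + 1 / 2) + 1 = ((m + (n + 1 / 2) + 1 : ℝ) : ℂ) := by
    push_cast; rfl
  rw [besselCoeff, arg_ofReal, Complex.Gamma_ofReal]
  simp only [map_mul, map_div₀, map_pow, map_neg, map_one, Complex.conj_ofReal,
    Complex.conj_natCast]

lemma ofReal_pi_ne_zero : (Real.pi : ℂ) ≠ 0 := Complex.ofReal_ne_zero.2 Real.pi_ne_zero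

lemma sphJ_eq (n : ℤ) {z : ℂ} (hz : z ≠ 0) :
    sphJ n z = (Real.pi : ℂ) ^ (1 / 2 : ℂ) *
      ((z / 2) ^ (n + 1) * besselEntire n ((z / 2) ^ 2)) := by
  have hz2 : z / 2 ≠ 0 := div_ne_zero hz two_ne_zero
  have cpow_pi_mul : ((Real.pi : ℂ) * z / 2) ^ (1 / 2 : ℂ) =
      (Real.pi : ℂ) ^ (1 / 2 : ℂ) * (z / 2) ^ (1 / 2 : ℂ) := by
    rw [mul_div_assoc, Complex.cpow_def_of_ne_zero (mul_ne_zero ofReal_pi_ne_zero hz2),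
      Complex.cpow_def_of_ne_zero ofReal_pi_ne_zero, Complex.cpow_def_of_ne_zero hz2,
      Complex.log_ofReal_mul Real.pi_pos hz2, add_mul, Complex.exp_add,
      Complex.ofReal_log Real.pi_pos.le]
  have cpow_term (m : ℕ) : (z / 2) ^ (1 / 2 : ℂ) * (z / 2) ^ (2 * (m : ℂ) + (n + 1 / 2)) =
      (z / 2) ^ (n + 1) * ((z / 2) ^ 2) ^ m := by
    rw [← Complex.cpow_add _ _ hz2, ← pow_mul, ← zpow_natCast, ← zpow_add₀ hz2,
      ← Complex.cpow_intCast]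
    congr 1
    push_cast
    ring
  rw [sphJ, cpow_pi_mul, mul_assoc]
  congr 1
  rw [besselJ, besselEntire, ← tsum_mul_left, ← tsum_mul_left]
  refine tsum_congr fun m => ?_
  rw [besselCoeff, mul_left_comm, cpow_term]
  ring

lemma sphEta_eq (n : ℤ) (z : ℂ) : sphEta n z = (-1) ^ n * sphJ (-n - 1) z := by
  have order_eq : -(n : ℂ) - 1 / 2 = ((-n - 1 : ℤ) : ℂ) + 1 / 2 := by push_cast; ring
  rw [sphEta, sphJ, order_eq, mul_assoc]

lemma sphJ_mul_sphJ {n k : ℤ} {p : ℕ} (h : n + k + 2 = p) {z : ℂ} (hz : z ≠ 0) :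
    sphJ n z * sphJ k z = Real.pi * (z / 2) ^ p *
      (besselEntire n ((z / 2) ^ 2) * besselEntire k ((z / 2) ^ 2)) := by
  have cpow_pi_mul_self :
      (Real.pi : ℂ) ^ (1 / 2 : ℂ) * (Real.pi : ℂ) ^ (1 / 2 : ℂ) = Real.pi := by
    rw [← Complex.cpow_add _ _ ofReal_pi_ne_zero, add_halves, Complex.cpow_one]
  have zpow_mul : (z / 2) ^ p = (z / 2) ^ (n + 1) * (z / 2) ^ (k + 1) := by
    rw [← zpow_natCast, ← h, ← zpow_add₀ (div_ne_zero hz two_ne_zero)]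
    congr 1
    ring
  rw [sphJ_eq n hz, sphJ_eq k hz, zpow_mul]
  linear_combination (z / 2) ^ (n + 1) * (z / 2) ^ (k + 1) * (besselEntire n ((z / 2) ^ 2) *
    besselEntire k ((z / 2) ^ 2)) * cpow_pi_mul_self

lemma sphJ_add_one (n : ℤ) {z : ℂ} (hz : z ≠ 0) :
    sphJ (n + 1) z = (2 * n + 1) / z * sphJ n z - sphJ (n - 1) z := by
  have hz2 : z / 2 ≠ 0 := div_ne_zero hz two_ne_zero
  rw [sphJ_eq _ hz, sphJ_eq _ hz, sphJ_eq _ hz, besselEntire_sub_one, sub_add_cancel,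
    zpow_add_one₀ hz2, zpow_add_one₀ hz2]
  field_simp
  ring

lemma sphJ_conj (n : ℤ) {z : ℂ} (hz : z ≠ 0) : sphJ n (conj z) = conj (sphJ n z) := by
  have cpow_pi : (Real.pi : ℂ) ^ (1 / 2 : ℂ) = ((Real.pi ^ (1 / 2 : ℝ) : ℝ) : ℂ) := by
    rw [Complex.ofReal_cpow Real.pi_pos.le, Complex.ofReal_div, Complex.ofReal_one,
      Complex.ofReal_ofNat]
  rw [sphJ_eq n hz, sphJ_eq n ((map_ne_zero _).2 hz), cpow_pi]
  simp only [map_mul, map_zpow₀, map_div₀, Complex.conj_ofNat, ← besselEntire_conj, map_pow,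
    Complex.conj_ofReal]

lemma sphEta_conj (n : ℤ) {z : ℂ} (hz : z ≠ 0) : sphEta n (conj z) = conj (sphEta n z) := by
  rw [sphEta_eq, sphEta_eq, sphJ_conj _ hz, map_mul, map_zpow₀, map_neg, map_one]

lemma cpow_pi_mul_besselCoeff_neg_one (m : ℕ) :
    (Real.pi : ℂ) ^ (1 / 2 : ℂ) * besselCoeff (-1) m = (-4) ^ m / ((2 * m).factorial : ℂ) := by
  induction m with
  | zero =>
    have Gamma_ne_zero := Gamma_add_half_add_one_ne_zero (-1) 0
    have arg_eq_half : ((0 : ℕ) : ℂ) + (((-1 : ℤ) : ℂ) + 1 / 2) + 1 = 1 / 2 := by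
      push_cast; ring
    rw [arg_eq_half, Complex.Gamma_one_half_eq] at Gamma_ne_zero
    rw [besselCoeff, arg_eq_half, Complex.Gamma_one_half_eq]
    simp only [Nat.factorial_zero, pow_zero, mul_zero, Nat.cast_one, one_mul]
    field_simp
  | succ m ih =>
    have ratio := mul_besselCoeff_succ (-1) m
    have factorial_succ : ((2 * (m + 1)).factorial : ℂ) =
        (2 * (m + 1)) * ((2 * m + 1) * (2 * m).factorial) := by
      rw [show 2 * (m + 1) = 2 * m + 1 + 1 by ring, Nat.factorial_succ, Nat.factorial_succ]
      push_cast
      ring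
    have factorial_ne_zero (k : ℕ) : (k.factorial : ℂ) ≠ 0 := by
      exact_mod_cast k.factorial_ne_zero
    rw [eq_div_iff (factorial_ne_zero _)] at ih ⊢
    rw [factorial_succ, pow_succ]
    push_cast at ratio
    linear_combination 4 * (Real.pi : ℂ) ^ (1 / 2 : ℂ) * ((2 * m).factorial : ℂ) * ratio - 4 * ih

lemma cpow_pi_mul_besselCoeff_zero (m : ℕ) :
    (Real.pi : ℂ) ^ (1 / 2 : ℂ) * besselCoeff 0 m =
      2 * ((-4) ^ m / ((2 * m + 1).factorial : ℂ)) := by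
  have lower := cpow_pi_mul_besselCoeff_neg_one m
  have odd_ne_zero : 2 * (m : ℂ) + 1 ≠ 0 := by exact_mod_cast (2 * m).succ_ne_zero
  have factorial_ne_zero : ((2 * m).factorial : ℂ) ≠ 0 := by
    exact_mod_cast (2 * m).factorial_ne_zero
  rw [show (-1 : ℤ) = 0 - 1 by rfl, besselCoeff_sub_one, eq_div_iff factorial_ne_zero] at lower
  rw [Nat.factorial_succ, mul_div_assoc', eq_div_iff (by
    push_cast
    exact mul_ne_zero odd_ne_zero factorial_ne_zero)]
  push_cast at lower ⊢
  linear_combination 2 * lower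

lemma sphJ_neg_one {z : ℂ} (hz : z ≠ 0) : sphJ (-1) z = Complex.cos z := by
  rw [sphJ_eq _ hz, neg_add_cancel, zpow_zero, one_mul, besselEntire, ← tsum_mul_left,
    ← (Complex.hasSum_cos z).tsum_eq]
  refine tsum_congr fun m => ?_
  rw [← mul_assoc, cpow_pi_mul_besselCoeff_neg_one, pow_mul z, div_mul_eq_mul_div, ← mul_pow,
    ← mul_pow]
  ring

lemma sphJ_zero {z : ℂ} (hz : z ≠ 0) : sphJ 0 z = Complex.sin z := by
  rw [sphJ_eq _ hz, zero_add, zpow_one, besselEntire, ← tsum_mul_left, ← tsum_mul_left,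
    ← (Complex.hasSum_sin z).tsum_eq]
  refine tsum_congr fun m => ?_
  have neg_four_pow : (-4) ^ m * ((z / 2) ^ 2) ^ m = (-1) ^ m * (z ^ 2) ^ m := by
    rw [← mul_pow, ← mul_pow]
    ring
  rw [mul_left_comm, ← mul_assoc _ (besselCoeff 0 m), cpow_pi_mul_besselCoeff_zero,
    pow_succ z (2 * m), pow_mul z, ← mul_assoc ((-1) ^ m), ← neg_four_pow]
  ring

/-! ### Riccati–Bessel sequences -/

/-- A family `X n`, `n ∈ ℤ`, obeying the recurrence of the Riccati–Bessel functions away from `0`,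
with derivatives prescribed at the orders `-1` and `0`; `sphJ` and `sphEta` are the examples. -/
structure IsRiccatiBessel (X : ℤ → ℂ → ℂ) : Prop where
  add_one (n : ℤ) {z : ℂ} (hz : z ≠ 0) : X (n + 1) z = (2 * n + 1) / z * X n z - X (n - 1) z
  hasDerivAt_neg_one {z : ℂ} (hz : z ≠ 0) : HasDerivAt (X (-1)) (-X 0 z) z
  hasDerivAt_zero {z : ℂ} (hz : z ≠ 0) : HasDerivAt (X 0) (X (-1) z) z

lemma isRiccatiBessel_sphJ : IsRiccatiBessel sphJ where
  add_one := sphJ_add_one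
  hasDerivAt_neg_one {z} hz := by
    rw [sphJ_zero hz]
    refine (Complex.hasDerivAt_cos z).congr_of_eventuallyEq ?_
    filter_upwards [isOpen_ne.mem_nhds hz] with w hw using sphJ_neg_one hw
  hasDerivAt_zero {z} hz := by
    rw [sphJ_neg_one hz]
    refine (Complex.hasDerivAt_sin z).congr_of_eventuallyEq ?_
    filter_upwards [isOpen_ne.mem_nhds hz] with w hw using sphJ_zero hw

namespace IsRiccatiBessel

variable {X Y : ℤ → ℂ → ℂ}

lemma reflect (hX : IsRiccatiBessel X) :
    IsRiccatiBessel fun n z => (-1) ^ n * X (-n - 1) z where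
  add_one n z hz := by
    have recurrence := hX.add_one (-n - 1) hz
    have neg_one_ne_zero : (-1 : ℂ) ≠ 0 := neg_ne_zero.2 one_ne_zero
    rw [show -(n + 1) - 1 = -n - 1 - 1 by ring, show -(n - 1) - 1 = -n - 1 + 1 by ring, recurrence,
      zpow_add_one₀ neg_one_ne_zero, zpow_sub_one₀ neg_one_ne_zero, inv_neg_one]
    push_cast
    ring
  hasDerivAt_neg_one hz := by
    simpa using (hX.hasDerivAt_zero hz).fun_neg
  hasDerivAt_zero hz := by
    simpa using hX.hasDerivAt_neg_one hz

lemma hasDerivAt_natCast (hX : IsRiccatiBessel X) (n : ℕ) {z : ℂ} (hz : z ≠ 0) :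
    HasDerivAt (X (n - 1)) (n / z * X (n - 1) z - X n z) z ∧
      HasDerivAt (X n) (X (n - 1) z - n / z * X n z) z := by
  induction n with
  | zero => exact ⟨by simpa using hX.hasDerivAt_neg_one hz, by simpa using hX.hasDerivAt_zero hz⟩
  | succ n ih =>
    obtain ⟨hasDerivAt_sub_one, hasDerivAt_self⟩ := ih
    have recurrence {w : ℂ} (hw : w ≠ 0) : X ((n + 1 : ℕ) : ℤ) w =
        (2 * n + 1) * w⁻¹ * X n w - X (n - 1) w := by
      have := hX.add_one n hw
      push_cast at this ⊢
      rw [this, div_eq_mul_inv]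
    rw [show ((n + 1 : ℕ) : ℤ) - 1 = n by push_cast; ring]
    constructor
    · refine hasDerivAt_self.congr_deriv ?_
      rw [recurrence hz]
      push_cast
      field_simp
      ring
    · refine (((((hasDerivAt_inv hz).const_mul (2 * (n : ℂ) + 1)).mul hasDerivAt_self).sub
        hasDerivAt_sub_one).congr_of_eventuallyEq ?_).congr_deriv ?_
      · filter_upwards [isOpen_ne.mem_nhds hz] with w hw using recurrence hw
      · rw [recurrence hz]
        push_cast
        field_simp
        ring

lemma hasDerivAt_pow_div (a : ℕ) {z : ℂ} (hz : z ≠ 0) :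
    HasDerivAt (fun w : ℂ => w ^ a) (a / z * z ^ a) z := by
  refine (hasDerivAt_pow a z).congr_deriv ?_
  cases a with
  | zero => simp only [Nat.cast_zero, zero_mul, zero_div]
  | succ a =>
    rw [Nat.add_sub_cancel]
    field_simp
    ring

lemma hasDerivAt_pow_mul (hX : IsRiccatiBessel X) (a : ℕ) {z : ℂ} (hz : z ≠ 0) :
    HasDerivAt (fun w => w ^ a * X a w) (z ^ a * X (a - 1) z) z :=
  ((hasDerivAt_pow_div a hz).mul (hX.hasDerivAt_natCast a hz).2).congr_deriv (by ring)

lemma hasDerivAt_pow_mul_sub_one (hX : IsRiccatiBessel X) (a : ℕ) {z : ℂ} (hz : z ≠ 0) :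
    HasDerivAt (fun w => w ^ a * X (a - 1) w)
      (2 * a / z * (z ^ a * X (a - 1) z) - z ^ a * X a z) z :=
  ((hasDerivAt_pow_div a hz).mul (hX.hasDerivAt_natCast a hz).1).congr_deriv (by ring)

/-- The vector of products of two Riccati–Bessel sequences of which `Phi` (for `sphJ`, `sphJ`) and
`Psi` (for `sphEta`, `sphJ`) are the two instances. -/
def productPair (X Y : ℤ → ℂ → ℂ) (a : ℕ) (z : ℂ) : Fin 2 → ℂ :=
  ![-X (a - 1) z * Y a z - X a z * Y (a - 1) z, -X (a - 1) z * Y (a - 1) z + X a z * Y a z]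

lemma hasDerivAt_productPair_zero (hX : IsRiccatiBessel X) (hY : IsRiccatiBessel Y) (a : ℕ) {z : ℂ}
    (hz : z ≠ 0) :
    HasDerivAt (fun w => w ^ (2 * a + 1) * (productPair X Y a w 0 + productPair X Y (a + 1) w 0))
      (2 * (2 * a + 1) * (z ^ (2 * a) * productPair X Y a z 0)) z := by
  refine ((((hX.hasDerivAt_pow_mul a hz).mul (hY.hasDerivAt_pow_mul a hz)).const_mul
    (-2 * (2 * (a : ℂ) + 1))).congr_of_eventuallyEq ?_).congr_deriv ?_
  · filter_upwards [isOpen_ne.mem_nhds hz] with w (hw : w ≠ 0)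
    simp only [productPair, Matrix.cons_val_zero, Nat.cast_add, Nat.cast_one, add_sub_cancel_right,
      hX.add_one a hw, hY.add_one a hw, Pi.mul_apply]
    push_cast
    field_simp
    ring
  · simp only [productPair, Matrix.cons_val_zero]
    ring

lemma hasDerivAt_productPair_one (hX : IsRiccatiBessel X) (hY : IsRiccatiBessel Y) (a : ℕ) {z : ℂ}
    (hz : z ≠ 0) :
    HasDerivAt (fun w => w ^ (2 * a + 2) * (productPair X Y a w 1 + productPair X Y (a + 1) w 1))
      (2 * (2 * a + 1) * (z ^ (2 * a + 1) * productPair X Y a z 1)) z := by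
  have hX₀ := hX.hasDerivAt_pow_mul a hz
  have hY₀ := hY.hasDerivAt_pow_mul a hz
  have hX₁ := hX.hasDerivAt_pow_mul_sub_one a hz
  have hY₁ := hY.hasDerivAt_pow_mul_sub_one a hz
  refine ((((hX₀.mul hY₀).const_mul ((2 * (a : ℂ) + 1) ^ 2)).sub
    (((hasDerivAt_id z).mul ((hX₁.mul hY₀).add (hX₀.mul hY₁))).const_mul
      (2 * (a : ℂ) + 1))).congr_of_eventuallyEq ?_).congr_deriv ?_
  · filter_upwards [isOpen_ne.mem_nhds hz] with w (hw : w ≠ 0)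
    simp only [productPair, Matrix.cons_val_one, Matrix.cons_val_fin_one, Nat.cast_add,
      Nat.cast_one, add_sub_cancel_right, hX.add_one a hw, hY.add_one a hw, Pi.mul_apply,
      Pi.add_apply, Pi.sub_apply, id]
    push_cast
    field_simp
    ring
  · simp only [productPair, Matrix.cons_val_one, Matrix.cons_val_fin_one, Pi.mul_apply,
      Pi.add_apply, id]
    field_simp
    ring

end IsRiccatiBessel

lemma isRiccatiBessel_sphEta : IsRiccatiBessel sphEta := by
  simpa only [← sphEta_eq] using isRiccatiBessel_sphJ.reflect

/-! ### Extension by continuity to the origin -/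

/-- `f` agrees away from `0` with a function that is continuous everywhere. The value `f 0` is left
free because `sphJ` and `sphEta` are meaningless at `0`. -/
def HasContinuousExtension {E : Type*} [TopologicalSpace E] (f : ℂ → E) : Prop :=
  ∃ g, Continuous g ∧ ∀ z ≠ 0, f z = g z

lemma extendZero_of_ne (f : ℂ → Fin 2 → ℂ) {z : ℂ} (hz : z ≠ 0) : extendZero f z = f z :=
  if_neg hz

lemma extendZero_eq {f g : ℂ → Fin 2 → ℂ} (hg : Continuous g) (h : ∀ z ≠ 0, f z = g z) :
    extendZero f = g := by
  have limUnder_eq : limUnder (𝓝[≠] (0 : ℂ)) f = g 0 := by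
    refine Tendsto.limUnder_eq ((hg.tendsto 0).mono_left nhdsWithin_le_nhds |>.congr' ?_)
    filter_upwards [self_mem_nhdsWithin] with z hz using (h z hz).symm
  funext z
  obtain rfl | hz := eq_or_ne z 0
  · rw [extendZero, if_pos rfl, limUnder_eq]
  · rw [extendZero_of_ne f hz, h z hz]

lemma continuous_extendZero {f : ℂ → Fin 2 → ℂ} (hf : HasContinuousExtension f) :
    Continuous (extendZero f) := by
  obtain ⟨g, hg, hfg⟩ := hf
  rwa [extendZero_eq hg hfg]

lemma extendZero_conj {f : ℂ → Fin 2 → ℂ} (hf : HasContinuousExtension f)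
    (hconj : ∀ z ≠ 0, f (conj z) = star (f z)) (z : ℂ) :
    extendZero f (conj z) = star (extendZero f z) := by
  obtain ⟨g, hg, hfg⟩ := hf
  have extendZero_eq_star : extendZero f = fun w => star (g (conj w)) :=
    extendZero_eq (hg.comp Complex.continuous_conj).star fun w hw => by
      rw [← hfg _ ((map_ne_zero _).2 hw), hconj w hw, star_star]
  rw [congrFun extendZero_eq_star z, star_star, extendZero_eq hg hfg]

lemma hasContinuousExtension_sphJ_mul_sphJ {n k : ℤ} (h : 0 ≤ n + k + 2) :
    HasContinuousExtension fun z => sphJ n z * sphJ k z := by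
  obtain ⟨p, hp⟩ := Int.eq_ofNat_of_zero_le h
  have := continuous_besselEntire
  exact ⟨_, by fun_prop, fun z hz => sphJ_mul_sphJ hp hz⟩

lemma hasContinuousExtension_sphEta_mul_sphJ {n k : ℤ} (h : n ≤ k + 1) :
    HasContinuousExtension fun z => sphEta n z * sphJ k z := by
  obtain ⟨g, hg, eq_g⟩ := hasContinuousExtension_sphJ_mul_sphJ (n := -n - 1) (k := k) (by lia)
  exact ⟨_, hg.const_mul ((-1) ^ n), fun z hz => by
    simp only [sphEta_eq, mul_assoc, ← eq_g z hz]⟩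

lemma hasContinuousExtension_productPair {X Y : ℤ → ℂ → ℂ} {a : ℕ}
    (h : ∀ n ∈ ({(a : ℤ) - 1, (a : ℤ)} : Set ℤ), ∀ k ∈ ({(a : ℤ) - 1, (a : ℤ)} : Set ℤ),
      HasContinuousExtension fun z => X n z * Y k z) :
    HasContinuousExtension (IsRiccatiBessel.productPair X Y a) := by
  simp only [mem_insert_iff, mem_singleton_iff, forall_eq_or_imp, forall_eq] at h
  obtain ⟨⟨⟨g₀₀, hg₀₀, eq₀₀⟩, ⟨g₀₁, hg₀₁, eq₀₁⟩⟩, ⟨g₁₀, hg₁₀, eq₁₀⟩, ⟨g₁₁, hg₁₁, eq₁₁⟩⟩ := h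
  refine ⟨fun z => ![-g₀₁ z - g₁₀ z, -g₀₀ z + g₁₁ z], by fun_prop, fun z hz => ?_⟩
  simp only [IsRiccatiBessel.productPair, neg_mul, ← eq₀₁ z hz, ← eq₁₀ z hz, ← eq₀₀ z hz,
    ← eq₁₁ z hz]

lemma productPair_conj {X Y : ℤ → ℂ → ℂ} {z : ℂ} (hX : ∀ n, X n (conj z) = conj (X n z))
    (hY : ∀ n, Y n (conj z) = conj (Y n z)) (a : ℕ) :
    IsRiccatiBessel.productPair X Y a (conj z) = star (IsRiccatiBessel.productPair X Y a z) := by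
  funext i
  fin_cases i <;> simp [IsRiccatiBessel.productPair, hX, hY]

/-! ### The ladders `Phi` and `Psi` -/

/-- A sequence of `ℂ²`-valued functions in which `P (a + 1)` arises from `P a` by the first order
equations that say, in integrated form, that `adjoint (S (a + 1))` sends the function
`x ↦ P a (l * x)` to `x ↦ -P (a + 1) (l * x)`. -/
structure IsBesselLadder (P : ℕ → ℂ → Fin 2 → ℂ) : Prop where
  continuous (a : ℕ) : Continuous (P a)
  apply_conj (a : ℕ) (z : ℂ) : P a (conj z) = star (P a z)
  hasDerivAt_zero (a : ℕ) {z : ℂ} (hz : z ≠ 0) :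
    HasDerivAt (fun w => w ^ (2 * a + 1) * (P a w 0 + P (a + 1) w 0))
      (2 * (2 * a + 1) * (z ^ (2 * a) * P a z 0)) z
  hasDerivAt_one (a : ℕ) {z : ℂ} (hz : z ≠ 0) :
    HasDerivAt (fun w => w ^ (2 * a + 2) * (P a w 1 + P (a + 1) w 1))
      (2 * (2 * a + 1) * (z ^ (2 * a + 1) * P a z 1)) z

lemma IsRiccatiBessel.isBesselLadder {X Y : ℤ → ℂ → ℂ} (hX : IsRiccatiBessel X)
    (hY : IsRiccatiBessel Y) (hext : ∀ a, HasContinuousExtension (productPair X Y a))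
    (hX_conj : ∀ n, ∀ z ≠ 0, X n (conj z) = conj (X n z))
    (hY_conj : ∀ n, ∀ z ≠ 0, Y n (conj z) = conj (Y n z)) :
    IsBesselLadder fun a => extendZero (productPair X Y a) where
  continuous a := continuous_extendZero (hext a)
  apply_conj a := extendZero_conj (hext a) fun z hz =>
    productPair_conj (fun n => hX_conj n z hz) (fun n => hY_conj n z hz) a
  hasDerivAt_zero a {z} hz := by
    rw [extendZero_of_ne _ hz]
    refine (hX.hasDerivAt_productPair_zero hY a hz).congr_of_eventuallyEq ?_
    filter_upwards [isOpen_ne.mem_nhds hz] with w hw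
    rw [extendZero_of_ne _ hw, extendZero_of_ne _ hw]
  hasDerivAt_one a {z} hz := by
    rw [extendZero_of_ne _ hz]
    refine (hX.hasDerivAt_productPair_one hY a hz).congr_of_eventuallyEq ?_
    filter_upwards [isOpen_ne.mem_nhds hz] with w hw
    rw [extendZero_of_ne _ hw, extendZero_of_ne _ hw]

lemma Phi_eq_extendZero (a : ℕ) : Phi a = extendZero (IsRiccatiBessel.productPair sphJ sphJ a) :=
  congrArg extendZero (funext fun _ => congrArg₂ (fun u v => ![u, v]) (by ring) (by ring))

lemma isBesselLadder_Phi : IsBesselLadder Phi := by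
  rw [funext Phi_eq_extendZero]
  refine isRiccatiBessel_sphJ.isBesselLadder isRiccatiBessel_sphJ
    (fun a => hasContinuousExtension_productPair fun n hn k hk =>
      hasContinuousExtension_sphJ_mul_sphJ ?_) (fun n z => sphJ_conj n) fun n z => sphJ_conj n
  rcases hn with rfl | rfl <;> rcases hk with rfl | rfl <;> lia

lemma isBesselLadder_Psi : IsBesselLadder Psi := by
  refine isRiccatiBessel_sphEta.isBesselLadder isRiccatiBessel_sphJ
    (fun a => hasContinuousExtension_productPair fun n hn k hk =>
      hasContinuousExtension_sphEta_mul_sphJ ?_) (fun n z => sphEta_conj n) fun n z => sphJ_conj n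
  rcases hn with rfl | rfl <;> rcases hk with rfl | rfl <;> lia

lemma neg_Phi_zero (z : ℂ) : -Phi 0 z = ![Complex.sin (2 * z), Complex.cos (2 * z)] := by
  have Phi_zero : Phi 0 = fun z => -![Complex.sin (2 * z), Complex.cos (2 * z)] := by
    refine extendZero_eq (by fun_prop) fun z hz => ?_
    simp only [Nat.cast_zero, zero_sub, sphJ_zero hz, sphJ_neg_one hz, Complex.sin_two_mul,
      Complex.cos_two_mul', Matrix.neg_cons, Matrix.neg_empty, neg_sub]
    congr 1
    ring
  rw [Phi_zero, neg_neg]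

lemma neg_Psi_zero (z : ℂ) : -Psi 0 z = ![Complex.cos (2 * z), -Complex.sin (2 * z)] := by
  have Psi_zero : Psi 0 = fun z => -![Complex.cos (2 * z), -Complex.sin (2 * z)] := by
    refine extendZero_eq (by fun_prop) fun z hz => ?_
    have sphEta_zero : sphEta 0 z = Complex.cos z := by
      rw [sphEta_eq, neg_zero, zero_sub, sphJ_neg_one hz, zpow_zero, one_mul]
    have sphEta_neg_one : sphEta (-1) z = -Complex.sin z := by
      rw [sphEta_eq, neg_neg, sub_self, sphJ_zero hz, zpow_neg_one, inv_neg_one, neg_one_mul]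
    simp only [Nat.cast_zero, zero_sub, sphJ_zero hz, sphJ_neg_one hz, sphEta_zero, sphEta_neg_one,
      Complex.sin_two_mul, Complex.cos_two_mul', Matrix.neg_cons, Matrix.neg_empty, neg_neg]
    congr 1
    · ring
    · congr 1
      ring
  rw [Psi_zero, neg_neg]

/-! ### The action of the adjoint of `T a` on trigonometric vectors -/

lemma mul_integral_comp_mul {F F' : ℂ → ℂ} (hF : Continuous F) (hF' : Continuous F')
    (h : ∀ z ≠ 0, HasDerivAt F (F' z) z) (l : ℂ) {t : ℝ} (ht : 0 ≤ t) :
    l * ∫ x in (0 : ℝ)..t, F' (l * x) = F (l * t) - F 0 := by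
  obtain rfl | hl := eq_or_ne l 0
  · rw [zero_mul, zero_mul, sub_self]
  have hasDerivAt_comp : ∀ x ∈ Ioo 0 t,
      HasDerivAt (fun x : ℝ => F (l * x)) (l * F' (l * x)) x := fun x hx => by
    have hlx : l * x ≠ 0 := mul_ne_zero hl (Complex.ofReal_ne_zero.2 hx.1.ne')
    refine (((h _ hlx).comp (x : ℂ) (hasDerivAt_const_mul l)).comp_ofReal).congr_deriv ?_
    exact mul_comm _ _
  rw [← intervalIntegral.integral_const_mul,
    intervalIntegral.integral_eq_sub_of_hasDerivAt_of_le ht (Continuous.continuousOn (by fun_prop))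
      hasDerivAt_comp (Continuous.intervalIntegrable (by fun_prop) _ _),
    Complex.ofReal_zero, mul_zero]

lemma pow_mul_eq_mul_integral {G g : ℂ → ℂ} (hG : Continuous G) (hg : Continuous g) {m : ℕ} {c : ℂ}
    (h : ∀ z ≠ 0, HasDerivAt (fun w => w ^ (m + 1) * G w) (c * (z ^ m * g z)) z) (l : ℂ) {t : ℝ}
    (ht : 0 ≤ t) :
    (t : ℂ) ^ (m + 1) * G (l * t) = c * ∫ x in (0 : ℝ)..t, (x : ℂ) ^ m * g (l * x) := by
  -- Both sides are continuous in `l`, so it is enough to treat `l ≠ 0`.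
  refine congrFun (Continuous.ext_on (dense_compl_singleton (0 : ℂ))
    (f := fun l => (t : ℂ) ^ (m + 1) * G (l * t))
    (g := fun l => c * ∫ x in (0 : ℝ)..t, (x : ℂ) ^ m * g (l * x)) (by fun_prop)
    (continuous_const.mul (intervalIntegral.continuous_parametric_intervalIntegral_of_continuous'
      (by fun_prop) _ _)) fun l (hl : l ≠ 0) => ?_) l
  have integral_eq := mul_integral_comp_mul (by fun_prop) (by fun_prop) h l ht
  simp only [mul_pow, mul_assoc, intervalIntegral.integral_const_mul] at integral_eq
  refine mul_left_cancel₀ (pow_ne_zero (m + 1) hl) ?_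
  rw [zero_pow m.succ_ne_zero, zero_mul, sub_zero] at integral_eq
  rw [← integral_eq]
  ring

lemma adjoint_tailShift_ofCont {G g : ℂ → ℂ} (hG : Continuous G) (hg : Continuous g) {m n : ℕ}
    (h : ∀ z ≠ 0, HasDerivAt (fun w => w ^ (m + 1) * (g w + G w))
      (((m : ℂ) + n + 1) * (z ^ m * g z)) z) (l : ℂ) :
    adjoint (tailShift m n) (ofCont (fun x => g (l * x)) (by fun_prop)) =
      -ofCont (fun x => G (l * x)) (by fun_prop) := by
  have hc := natCast_add_add_one_ne_zero m n
  have continuous_add : Continuous fun x : ℝ => g (l * x) + G (l * x) := by fun_prop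
  have hardyOp_eq : hardyOp m (ofCont (fun x => g (l * x)) (by fun_prop)) =
      ofCont (fun x => ((m : ℂ) + n + 1)⁻¹ * (g (l * x) + G (l * x))) (by fun_prop) := by
    refine hardyOp_ofCont _ _ fun t ht => ?_
    rw [mul_left_comm, inv_mul_eq_iff_eq_mul₀ hc]
    exact pow_mul_eq_mul_integral (G := fun z => g z + G z) (by fun_prop) hg h l ht.1.le
  rw [adjoint_tailShift, _root_.sub_apply, _root_.smul_apply, one_apply_eq_self, hardyOp_eq,
    ofCont_const_mul _ continuous_add, smul_inv_smul₀ hc, sub_eq_iff_eq_add, neg_add_eq_sub,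
    ← ofCont_sub]
  simp only [add_sub_cancel_right]

/-- The class in `L² × L²` of a continuous `ℂ²`-valued function. -/
def vecOfCont (P : ℝ → Fin 2 → ℂ) (hP : Continuous P) : H :=
  vec (ofCont (fun x => P x 0) (by fun_prop)) (ofCont (fun x => P x 1) (by fun_prop))

lemma vecOfCont_neg {P : ℝ → Fin 2 → ℂ} (hP : Continuous P) :
    vecOfCont (fun x => -P x) hP.neg = -vecOfCont P hP := rfl

lemma vecOfCont_ae (P : ℝ → Fin 2 → ℂ) (hP : Continuous P) :
    ∀ᵐ x ∂μ01, P x = ![(vecOfCont P hP).fst x, (vecOfCont P hP).snd x] := by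
  filter_upwards [ofCont_ae (fun x => P x 0) (by fun_prop),
    ofCont_ae (fun x => P x 1) (by fun_prop)] with x h₀ h₁
  funext i
  fin_cases i
  exacts [h₀.symm, h₁.symm]

namespace IsBesselLadder

variable {P : ℕ → ℂ → Fin 2 → ℂ}

lemma continuous_comp_mul (hP : IsBesselLadder P) (a : ℕ) (l : ℂ) :
    Continuous fun x : ℝ => P a (l * x) :=
  (hP.continuous a).comp (by fun_prop)

lemma adjoint_S_succ_vecOfCont (hP : IsBesselLadder P) (a : ℕ) (l : ℂ) :
    adjoint (S (a + 1)) (vecOfCont (fun x => P a (l * x)) (hP.continuous_comp_mul a l)) =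
      -vecOfCont (fun x => P (a + 1) (l * x)) (hP.continuous_comp_mul (a + 1) l) := by
  have := hP.continuous a
  have := hP.continuous (a + 1)
  rw [vecOfCont, adjoint_S_succ_vec]
  refine congrArg₂ vec ?_ ?_
  · refine adjoint_tailShift_ofCont (g := fun z => P a z 0) (G := fun z => P (a + 1) z 0)
      (by fun_prop) (by fun_prop) (fun z hz => (hP.hasDerivAt_zero a hz).congr_deriv ?_) l
    push_cast
    ring
  · refine adjoint_tailShift_ofCont (g := fun z => P a z 1) (G := fun z => P (a + 1) z 1)
      (by fun_prop) (by fun_prop) (fun z hz => (hP.hasDerivAt_one a hz).congr_deriv ?_) l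
    push_cast
    ring

lemma adjoint_T_vecOfCont (hP : IsBesselLadder P) (a : ℕ) (l : ℂ) :
    adjoint (T a) (vecOfCont (fun x => -P 0 (l * x)) (hP.continuous_comp_mul 0 l).neg) =
      vecOfCont (fun x => P a (l * x)) (hP.continuous_comp_mul a l) := by
  induction a with
  | zero =>
    rw [vecOfCont_neg (hP.continuous_comp_mul 0 l), adjoint_T_zero, neg_apply, one_apply_eq_self,
      neg_neg]
  | succ a ih =>
    rw [adjoint_T_succ, neg_apply, mul_apply_eq_comp, ih, hP.adjoint_S_succ_vecOfCont, neg_neg]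

end IsBesselLadder

lemma sinCos_eq (l : ℂ) : sinCos l = vecOfCont (fun x => -Phi 0 (l * x))
    (isBesselLadder_Phi.continuous_comp_mul 0 l).neg := by
  simp only [neg_Phi_zero, ← mul_assoc]
  rfl

lemma cosNegSin_eq (l : ℂ) : cosNegSin l = vecOfCont (fun x => -Psi 0 (l * x))
    (isBesselLadder_Psi.continuous_comp_mul 0 l).neg := by
  simp only [neg_Psi_zero, ← mul_assoc]
  rfl

lemma Phi_ae_eq_adjoint_T (a : ℕ) (l : ℂ) : ∀ᵐ x : ℝ ∂μ01, Phi a (l * x) =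
    ![(adjoint (T a) (sinCos l)).fst x, (adjoint (T a) (sinCos l)).snd x] := by
  rw [sinCos_eq, isBesselLadder_Phi.adjoint_T_vecOfCont]
  exact vecOfCont_ae _ _

lemma Psi_ae_eq_adjoint_T (a : ℕ) (l : ℂ) : ∀ᵐ x : ℝ ∂μ01, Psi a (l * x) =
    ![(adjoint (T a) (cosNegSin l)).fst x, (adjoint (T a) (cosNegSin l)).snd x] := by
  rw [cosNegSin_eq, isBesselLadder_Psi.adjoint_T_vecOfCont]
  exact vecOfCont_ae _ _

/-! ### Integral transforms -/

lemma integrable_dotProduct {P : ℝ → Fin 2 → ℂ} (hP : Continuous P) (F : H) :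
    Integrable (fun t => P t ⬝ᵥ ![F.fst t, F.snd t]) μ01 := by
  simp only [Matrix.vec2_dotProduct, Matrix.cons_val_zero, Matrix.cons_val_one,
    Matrix.cons_val_fin_one]
  exact ((memLp_of_continuous (by fun_prop)).integrable_mul (Lp.memLp F.fst)).add
    ((memLp_of_continuous (by fun_prop)).integrable_mul (Lp.memLp F.snd))

lemma inner_vecOfCont (P : ℝ → Fin 2 → ℂ) (hP : Continuous P) (F : H) :
    inner ℂ (vecOfCont P hP) F = ∫ t in (0 : ℝ)..1, star (P t) ⬝ᵥ ![F.fst t, F.snd t] := by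
  rw [← integral_μ01, WithLp.prod_inner_apply, vecOfCont, inner_ofCont, inner_ofCont,
    ← integral_add]
  · simp only [Matrix.vec2_dotProduct, Matrix.cons_val_zero, Matrix.cons_val_one,
      Matrix.cons_val_fin_one]
    rfl
  · exact (memLp_of_continuous (by fun_prop)).integrable_mul (Lp.memLp F.fst)
  · exact (memLp_of_continuous (by fun_prop)).integrable_mul (Lp.memLp F.snd)

lemma IsBesselLadder.integral_dotProduct {P : ℕ → ℂ → Fin 2 → ℂ} (hP : IsBesselLadder P) (a : ℕ)
    (l : ℂ) (F : H) :
    IntervalIntegrable (fun t : ℝ => P a (l * t) ⬝ᵥ ![F.fst t, F.snd t]) volume 0 1 ∧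
    ∫ t in (0 : ℝ)..1, P a (l * t) ⬝ᵥ ![F.fst t, F.snd t] =
      ∫ t in (0 : ℝ)..1, -P 0 (l * t) ⬝ᵥ ![(T a F).fst t, (T a F).snd t] := by
  refine ⟨(intervalIntegrable_iff_integrableOn_Ioo_of_le zero_le_one).2
    (integrable_dotProduct (hP.continuous_comp_mul a l) F), ?_⟩
  have star_comp (b : ℕ) (t : ℝ) : star (P b (conj l * t)) = P b (l * t) := by
    rw [← hP.apply_conj, map_mul, Complex.conj_conj, Complex.conj_ofReal]
  have inner_eq := ContinuousLinearMap.adjoint_inner_left (T a) F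
    (vecOfCont (fun x => -P 0 (conj l * x)) (hP.continuous_comp_mul 0 (conj l)).neg)
  rw [hP.adjoint_T_vecOfCont, inner_vecOfCont, inner_vecOfCont] at inner_eq
  simpa only [star_neg, star_comp] using inner_eq

lemma integral_Phi_dotProduct (a : ℕ) (l : ℂ) (F : H) :
    IntervalIntegrable (fun t : ℝ => Phi a (l * t) ⬝ᵥ ![F.fst t, F.snd t]) volume 0 1 ∧
    ∫ t in (0 : ℝ)..1, Phi a (l * t) ⬝ᵥ ![F.fst t, F.snd t] =
      ∫ t in (0 : ℝ)..1, ![Complex.sin (2 * l * t), Complex.cos (2 * l * t)] ⬝ᵥ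
        ![(T a F).fst t, (T a F).snd t] := by
  simpa only [neg_Phi_zero, ← mul_assoc] using isBesselLadder_Phi.integral_dotProduct a l F

lemma integral_Psi_dotProduct (a : ℕ) (l : ℂ) (F : H) :
    IntervalIntegrable (fun t : ℝ => Psi a (l * t) ⬝ᵥ ![F.fst t, F.snd t]) volume 0 1 ∧
    ∫ t in (0 : ℝ)..1, Psi a (l * t) ⬝ᵥ ![F.fst t, F.snd t] =
      ∫ t in (0 : ℝ)..1, ![Complex.cos (2 * l * t), -Complex.sin (2 * l * t)] ⬝ᵥ
        ![(T a F).fst t, (T a F).snd t] := by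
  simpa only [neg_Psi_zero, ← mul_assoc] using isBesselLadder_Psi.integral_dotProduct a l F

lemma T_vec (a : ℕ) (f g : L2C) : T a (vec f g) = vec (T₁ a f) (T₂ a g) := by
  rw [T_eq_diagOp, diagOp_vec]

lemma exists_equiv_orthogonal_iSup_N (a : ℕ) :
    ∃ e : H ≃L[ℂ] ↥(⨆ k : Finset.Icc 1 a, N k)ᗮ,
      (∀ F : H, (e F : H) = T a F) ∧
      ∀ G : ↥(⨆ k : Finset.Icc 1 a, N k)ᗮ, e.symm G = B a G := by
  rw [← ker_adjoint_T]
  exact ⟨equivOrthogonalKerAdjoint (leftInverse_B_T a), fun _ => rfl, fun _ => rfl⟩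

end

end AKNS

theorem mainTheorem10 (a : ℕ) :
    -- `T_a` acts diagonally, is bounded and one-to-one
    (∀ f g : AKNS.L2C, AKNS.T a (AKNS.vec f g) = AKNS.vec (AKNS.T₁ a f) (AKNS.T₂ a g)) ∧
    (∃ C : ℝ, ∀ F : AKNS.H, ‖AKNS.T a F‖ ≤ C * ‖F‖) ∧
    Function.Injective (AKNS.T a) ∧
    -- it turns Bessel integrals into trigonometric ones
    (∀ (p q : AKNS.L2C) (l : ℂ),
      IntervalIntegrable (fun t : ℝ => AKNS.Phi a (l * t) ⬝ᵥ ![p t, q t]) volume 0 1 ∧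
      ∫ t in (0:ℝ)..1, AKNS.Phi a (l * t) ⬝ᵥ ![p t, q t] =
        ∫ t in (0:ℝ)..1, ![Complex.sin (2 * l * t), Complex.cos (2 * l * t)] ⬝ᵥ
          ![(AKNS.T a (AKNS.vec p q)).fst t, (AKNS.T a (AKNS.vec p q)).snd t]) ∧
    (∀ (p q : AKNS.L2C) (l : ℂ),
      IntervalIntegrable (fun t : ℝ => AKNS.Psi a (l * t) ⬝ᵥ ![p t, q t]) volume 0 1 ∧
      ∫ t in (0:ℝ)..1, AKNS.Psi a (l * t) ⬝ᵥ ![p t, q t] =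
        ∫ t in (0:ℝ)..1, ![Complex.cos (2 * l * t), -Complex.sin (2 * l * t)] ⬝ᵥ
          ![(AKNS.T a (AKNS.vec p q)).fst t, (AKNS.T a (AKNS.vec p q)).snd t]) ∧
    -- the adjoint: components, action on the trigonometric vectors, kernel
    (∀ f g : AKNS.L2C, ContinuousLinearMap.adjoint (AKNS.T a) (AKNS.vec f g) =
      AKNS.vec (ContinuousLinearMap.adjoint (AKNS.T₁ a) f)
        (ContinuousLinearMap.adjoint (AKNS.T₂ a) g)) ∧
    (∀ l : ℂ, ∀ᵐ x : ℝ ∂AKNS.μ01, AKNS.Phi a (l * x) =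
      ![(ContinuousLinearMap.adjoint (AKNS.T a) (AKNS.sinCos l)).fst x,
        (ContinuousLinearMap.adjoint (AKNS.T a) (AKNS.sinCos l)).snd x]) ∧
    (∀ l : ℂ, ∀ᵐ x : ℝ ∂AKNS.μ01, AKNS.Psi a (l * x) =
      ![(ContinuousLinearMap.adjoint (AKNS.T a) (AKNS.cosNegSin l)).fst x,
        (ContinuousLinearMap.adjoint (AKNS.T a) (AKNS.cosNegSin l)).snd x]) ∧
    iSupIndep (fun k : Finset.Icc 1 a => AKNS.N k) ∧
    (ContinuousLinearMap.adjoint (AKNS.T a)).ker =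
      (⨆ k : Finset.Icc 1 a, AKNS.N k) ∧
    -- `T_a` is an isomorphism onto the orthogonal complement, with inverse `B_a`
    (∃ e : AKNS.H ≃L[ℂ] ↥(⨆ k : Finset.Icc 1 a, AKNS.N k)ᗮ,
      (∀ F : AKNS.H, (e F : AKNS.H) = AKNS.T a F) ∧
      ∀ G : ↥(⨆ k : Finset.Icc 1 a, AKNS.N k)ᗮ, e.symm G = AKNS.B a G) := by
  exact ⟨AKNS.T_vec a, ⟨‖AKNS.T a‖, (AKNS.T a).le_opNorm⟩, (AKNS.leftInverse_B_T a).injective,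
    fun p q l => AKNS.integral_Phi_dotProduct a l (AKNS.vec p q),
    fun p q l => AKNS.integral_Psi_dotProduct a l (AKNS.vec p q),
    AKNS.adjoint_T_vec a, AKNS.Phi_ae_eq_adjoint_T a, AKNS.Psi_ae_eq_adjoint_T a,
    AKNS.iSupIndep_N a, AKNS.ker_adjoint_T a, AKNS.exists_equiv_orthogonal_iSup_N a⟩
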